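/- Let $k$ be a field and let $\Lambda$ be a finite-dimensional $k$-algebra that is basic (the left module $\Lambda$ is a direct sum of pairwise non-isomorphic indecomposable modules), self-injective, and representation-finite. Let $\Lambda\text{-mod}$ be the category of finite-dimensional left $\Lambda$-modules, and let $m$ be the number of isomorphism classes of indecomposable objects of $\Lambda\text{-mod}$. Let $E$ be the basic $\Lambda$-module with $\operatorname{add}(E)=\Lambda\text{-mod}$, let $\Gamma=\operatorname{End}_\Lambda(E)^{\mathrm{op}}$ be the Auslander algebra of $\Lambda$, let $e\in\Gamma$ be the idempotent given by a projection of $E$ onto its direct summand $\Lambda$, and let $\underline{\Gamma}=\Gamma/\Gamma e\Gamma$ be the stable Auslander algebra, with $\underline{\Gamma}\text{-mod}$ its category of finite-dimensional left modules. Let $\mathcal S(\Lambda)$ be the full subcategory of the monomorphisms in the category of morphisms $(M_1\to M_0)$ of $\Lambda\text{-mod}$. For a morphism $f\colon M_1\to M_0$ in $\Lambda\text{-mod}$ put $\alpha(f)=\operatorname{Coker}\big(\operatorname{Hom}_\Lambda(E,f)\colon \operatorname{Hom}_\Lambda(E,M_1)\to\operatorname{Hom}_\Lambda(E,M_0)\big)$,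 a left $\Gamma$-module, and for $(M_1\to M_0)$ in $\mathcal S(\Lambda)$ put $\epsilon(M_1\to M_0)=(M_0\to M_0/M_1)$. Define functors $\mathcal S(\Lambda)\to\underline{\Gamma}\text{-mod}$ by $$F=\underline{\Gamma}\otimes_\Gamma\alpha(-),\qquad G=\underline{\Gamma}\otimes_\Gamma\alpha(\epsilon(-)).$$ An additive subcategory is a full subcategory closed under finite direct sums and direct summands, and $\operatorname{add}(X)$ is the smallest one containing $X$. Let $\mathcal U$ be the smallest additive subcategory of $\mathcal S(\Lambda)$ that contains $(E\xrightarrow{\mathrm{id}}E)$ and all monomorphisms $(M\to I)$ with $I$ a projective-injective $\Lambda$-module, and let $\mathcal V=\operatorname{add}\big((E\xrightarrow{\mathrm{id}}E)\oplus(0\to E)\big)$ in $\mathcal S(\Lambda)$. For an additive subcategory $\mathcal B$ of $\mathcal S(\Lambda)$, the quotient category $\mathcal S(\Lambda)/\mathcal B$ has the same objects, and its morphisms are those of $\mathcal S(\Lambda)$ modulo the morphisms that factor through an object of $\mathcal B$. Then $\mathcal U$ and $\mathcal V$ each have exactly $2m$ indecomposable objects up to isomorphism, and: (i) $F$ induces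 an equivalence of categories $\mathcal S(\Lambda)/\mathcal U\to\underline{\Gamma}\text{-mod}$; (ii) $G$ induces an equivalence of categories $\mathcal S(\Lambda)/\mathcal V\to\underline{\Gamma}\text{-mod}$. -/

import Mathlib

open CategoryTheory CategoryTheory.Limits
open scoped TensorProduct

universe u

noncomputable section

namespace SubmoduleCategory

/-! ### Additive subcategories, indecomposable objects and quotient categories -/

section Additive

variable {C : Type*} [Category* C] [Preadditive C]

/-- A (full) subcategory is additive if it is closed under finite direct sums and under direct
summands. -/
structure IsAdditiveSubcategory (P : ObjectProperty C) : Prop where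
  zero : ∀ X : C, IsZero X → P X
  directSum : ∀ (X Y : C) (b : BinaryBicone X Y), Nonempty b.IsBilimit → P X → P Y → P b.pt
  summand : ∀ (X Y : C) (b : BinaryBicone X Y), Nonempty b.IsBilimit → P b.pt → P X

/-- The smallest additive subcategory that contains all objects satisfying `P`. -/
def additiveClosure (P : ObjectProperty C) : ObjectProperty C :=
  fun X => ∀ Q : ObjectProperty C, IsAdditiveSubcategory Q → P ≤ Q → Q X

/-- `add(A)`: the smallest additive subcategory that contains the object `A`. -/
def add (A : C) : ObjectProperty C :=
  additiveClosure (fun X => X = A)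

/-- Two morphisms are related if their difference factors through an object in `P`. -/
def factorsRel (P : ObjectProperty C) : HomRel C :=
  fun X Y f g => ∃ (Z : C) (a : X ⟶ Z) (b : Z ⟶ Y), P Z ∧ f - g = a ≫ b

/-- The quotient category `C / P`: the objects are those of `C`, and morphisms are identified
if their difference factors through an object in `P` (for additive `P` in an additive category
this relation is already a congruence). -/
abbrev AdditiveQuotient (P : ObjectProperty C) := CategoryTheory.Quotient (factorsRel P)

/-- The functor `F` induces an equivalence of categories `C / P ⥤ D`: it identifies morphisms
that become equal in `C / P`, and the resulting functor on `C / P` is an equivalence. -/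
def InducesEquivalence {D : Type*} [Category* D] (P : ObjectProperty C) (F : C ⥤ D) : Prop :=
  ∃ h : ∀ (X Y : C) (f g : X ⟶ Y), factorsRel P f g → F.map f = F.map g,
    (CategoryTheory.Quotient.lift (factorsRel P) F h : AdditiveQuotient P ⥤ D).IsEquivalence

variable [HasBinaryBiproducts C]

/-- The set of isomorphism classes of indecomposable objects that lie in `P`. -/
def indClasses (P : ObjectProperty C) : Set (_root_.Quotient (isIsomorphicSetoid C)) :=
  {c | ∃ X : C, Indecomposable X ∧ P X ∧ c = Quotient.mk _ X}

/-- An object is basic if it is a finite direct sum of pairwise non-isomorphic indecomposable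
objects. -/
def IsBasic [HasFiniteBiproducts C] (X : C) : Prop :=
  ∃ (n : ℕ) (N : Fin n → C), (∀ i, Indecomposable (N i)) ∧
    (∀ i j, Nonempty (N i ≅ N j) → i = j) ∧ Nonempty (X ≅ ⨁ N)

end Additive

/-! ### The submodule category -/

section Submodule

variable (Λ : Type u) [Ring Λ]

instance : HasFiniteBiproducts (FGModuleCat.{u} Λ) :=
  HasFiniteBiproducts.of_hasFiniteCoproducts

instance : HasBinaryBiproducts (FGModuleCat.{u} Λ) :=
  hasBinaryBiproducts_of_finite_biproducts _

/-- The class of monomorphisms, among all objects of the category of morphisms in the category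
of finitely generated `Λ`-modules. -/
def isMono : ObjectProperty (Arrow (FGModuleCat.{u} Λ)) := fun f => Mono f.hom

/-- The submodule category `S(Λ)`. -/
abbrev Sub := (isMono Λ).FullSubcategory

variable {Λ}

/-- The object of `S(Λ)` given by a monomorphism. -/
def Sub.mk {M N : FGModuleCat.{u} Λ} (f : M ⟶ N) [h : Mono f] : Sub Λ :=
  ⟨Arrow.mk f, h⟩

/-- The zero `Λ`-module. -/
abbrev zeroModule : FGModuleCat.{u} Λ := FGModuleCat.of Λ PUnit.{u + 1}

instance (N : FGModuleCat.{u} Λ) : Mono (0 : zeroModule ⟶ N) :=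
  ⟨fun _ _ _ => by ext⟩

instance : HasBinaryBiproducts (Sub Λ) where
  has_binary_biproduct X Y := by
    have : Mono X.obj.hom := X.property
    have : Mono Y.obj.hom := Y.property
    let b : BinaryBicone X Y :=
      { pt := Sub.mk (biprod.map X.obj.hom Y.obj.hom)
        fst := ObjectProperty.homMk
          (Arrow.homMk (u := biprod.fst) (v := biprod.fst) (by simp [Sub.mk]))
        snd := ObjectProperty.homMk
          (Arrow.homMk (u := biprod.snd) (v := biprod.snd) (by simp [Sub.mk]))
        inl := ObjectProperty.homMk
          (Arrow.homMk (u := biprod.inl) (v := biprod.inl) (by simp [Sub.mk]))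
        inr := ObjectProperty.homMk
          (Arrow.homMk (u := biprod.inr) (v := biprod.inr) (by simp [Sub.mk]))
        inl_fst := by ext1; ext1 <;> exact biprod.inl_fst
        inl_snd := by ext1; ext1 <;> exact biprod.inl_snd
        inr_fst := by ext1; ext1 <;> exact biprod.inr_fst
        inr_snd := by ext1; ext1 <;> exact biprod.inr_snd }
    exact HasBinaryBiproduct.mk ⟨b, isBinaryBilimitOfTotal b (by
      ext1; ext1
      · exact biprod.total
      · exact biprod.total)⟩

/-- The inclusion `η` of `S(Λ)` into the category of morphisms. -/
abbrev η : Sub Λ ⥤ Arrow (FGModuleCat.{u} Λ) := (isMono Λ).ι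

/-- The cokernel functor `ε` from `S(Λ)` to the category of morphisms,
`(M₁ ⟶ M₀) ↦ (M₀ ⟶ M₀ / M₁)`. -/
def ε : Sub Λ ⥤ Arrow (FGModuleCat.{u} Λ) where
  obj f := Arrow.mk (cokernel.π f.obj.hom)
  map φ := Arrow.homMk (u := φ.hom.right) (v := (coker _).map φ.hom) (by simp)
  map_id X := by
    ext1
    · rfl
    · exact (coker _).map_id X.obj
  map_comp φ ψ := by
    ext1
    · rfl
    · exact (coker _).map_comp φ.hom ψ.hom

end Submodule

/-! ### Tensor products over non-commutative rings -/

section Tensor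

variable {A B : Type u} [Ring A] [Ring B] (φ : A →+* B)

/-- The relations `b φ(a) ⊗ m = b ⊗ a m` that cut `B ⊗_A M` out of `B ⊗_ℤ M`. -/
def balancedRel (M : Type u) [AddCommGroup M] [Module A M] : Submodule B (B ⊗[ℤ] M) :=
  Submodule.span B {x | ∃ (b : B) (a : A) (m : M), x = (b * φ a) ⊗ₜ m - b ⊗ₜ (a • m)}

/-- The left `B`-module `B ⊗_A M`, where `B` is a right `A`-module by means of `φ`. -/
abbrev BalancedTensor (M : Type u) [AddCommGroup M] [Module A M] : Type u :=
  (B ⊗[ℤ] M) ⧸ balancedRel φ M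

/-- `B ⊗_ℤ f` as a homomorphism of left `B`-modules. -/
def lTensor {M N : Type u} [AddCommGroup M] [AddCommGroup N] (f : M →+ N) :
    B ⊗[ℤ] M →ₗ[B] B ⊗[ℤ] N :=
  TensorProduct.AlgebraTensorModule.map LinearMap.id f.toIntLinearMap

/-- The homomorphism `B ⊗_A f`. -/
def BalancedTensor.map {M N : Type u} [AddCommGroup M] [Module A M] [AddCommGroup N] [Module A N]
    (f : M →ₗ[A] N) : BalancedTensor φ M →ₗ[B] BalancedTensor φ N :=
  Submodule.mapQ _ _ (lTensor f.toAddMonoidHom) (by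
    rw [balancedRel, Submodule.span_le]
    rintro _ ⟨b, a, m, rfl⟩
    exact Submodule.subset_span ⟨b, a, f m, by simp [lTensor]⟩)

/-- The functor `B ⊗_A -` from left `A`-modules to left `B`-modules. -/
def tensorFunctor : ModuleCat.{u} A ⥤ ModuleCat.{u} B where
  obj M := ModuleCat.of B (BalancedTensor φ M)
  map f := ModuleCat.ofHom (BalancedTensor.map φ f.hom)
  map_id M := by
    refine ModuleCat.hom_ext (LinearMap.ext fun x => ?_)
    obtain ⟨x, rfl⟩ := Submodule.Quotient.mk_surjective _ x
    induction x with
    | zero => simp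
    | add x y hx hy => simpa using congrArg₂ (· + ·) hx hy
    | tmul b m => simp [BalancedTensor.map, lTensor]
  map_comp f g := by
    refine ModuleCat.hom_ext (LinearMap.ext fun x => ?_)
    obtain ⟨x, rfl⟩ := Submodule.Quotient.mk_surjective _ x
    induction x with
    | zero => simp
    | add x y hx hy => simpa using congrArg₂ (· + ·) hx hy
    | tmul b m => simp [BalancedTensor.map, lTensor]

theorem finite_balancedTensor (M : Type u) [AddCommGroup M] [Module A M] [Module.Finite A M] :
    Module.Finite B (BalancedTensor φ M) := by
  classical
  obtain ⟨s, hs⟩ := Module.Finite.fg_top (R := A) (M := M)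
  refine ⟨⟨s.image fun m => (balancedRel φ M).mkQ ((1 : B) ⊗ₜ[ℤ] m), ?_⟩⟩
  set S := Submodule.span B
    (SetLike.coe (s.image fun m => (balancedRel φ M).mkQ ((1 : B) ⊗ₜ[ℤ] m))) with hS
  have key : ∀ m : M, m ∈ Submodule.span A (s : Set M) →
      ∀ b : B, (balancedRel φ M).mkQ (b ⊗ₜ[ℤ] m) ∈ S := by
    intro m hm
    induction hm using Submodule.span_induction with
    | mem x hx =>
      intro b
      have h1 : b ⊗ₜ[ℤ] x = b • ((1 : B) ⊗ₜ[ℤ] x) := by simp [TensorProduct.smul_tmul']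
      rw [h1, map_smul]
      exact S.smul_mem _ (Submodule.subset_span (by
        simp only [Finset.coe_image]; exact ⟨x, hx, rfl⟩))
    | zero => intro b; simp
    | add x y _ _ hx hy =>
      intro b
      rw [TensorProduct.tmul_add, map_add]
      exact S.add_mem (hx b) (hy b)
    | smul a x _ hx =>
      intro b
      have h1 : (balancedRel φ M).mkQ (b ⊗ₜ[ℤ] (a • x)) =
          (balancedRel φ M).mkQ ((b * φ a) ⊗ₜ[ℤ] x) := by
        symm
        rw [← sub_eq_zero, ← map_sub, Submodule.mkQ_apply, Submodule.Quotient.mk_eq_zero]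
        exact Submodule.subset_span ⟨b, a, x, rfl⟩
      rw [h1]
      exact hx _
  rw [eq_top_iff]
  rintro x -
  obtain ⟨x, rfl⟩ := (balancedRel φ M).mkQ_surjective x
  induction x with
  | zero => simp
  | add x y hx hy => rw [map_add]; exact S.add_mem hx hy
  | tmul b m => exact key m (by rw [hs]; trivial) b

end Tensor

/-! ### The (stable) Auslander algebra and the functors -/

section Auslander

variable {Λ : Type u} [Ring Λ] (E : FGModuleCat.{u} Λ)

/-- The algebra `End(E)ᵒᵖ`. For an additive generator `E` it is the Auslander algebra of `Λ`. -/
abbrev Aus : Type u := (End E)ᵐᵒᵖ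

/-- The functor `α`, the cokernel of `Hom(E, f)`. -/
def α : Arrow (FGModuleCat.{u} Λ) ⥤ ModuleCat.{u} (Aus E) :=
  (preadditiveCoyonedaObj E).mapArrow ⋙ coker _

variable {E} (r : Retract (FGModuleCat.of Λ Λ) E)

/-- The idempotent of `End(E)ᵒᵖ` given by the projection of `E` onto its summand `Λ`. -/
def idem : Aus E := MulOpposite.op (r.r ≫ r.i)

/-- The algebra `Γ / ΓeΓ`, where `Γ = End(E)ᵒᵖ`. -/
abbrev StableAus : Type u := Aus E ⧸ (TwoSidedIdeal.span {idem r}).asIdeal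

/-- The functor `(Γ / ΓeΓ) ⊗_Γ -`. -/
def q : ModuleCat.{u} (Aus E) ⥤ ModuleCat.{u} (StableAus r) :=
  tensorFunctor (Ideal.Quotient.mk (TwoSidedIdeal.span {idem r}).asIdeal)

open ModuleCat in
theorem finite_hom (k : Type*) [Field k] [Algebra k Λ] [Module.Finite k Λ]
    (M : FGModuleCat.{u} Λ) : Module.Finite (Aus E) (E ⟶ M) := by
  have h1 : ∀ N : FGModuleCat.{u} Λ, Module.Finite k N.obj := fun N =>
    have : Module.Finite Λ N.obj := N.property
    Module.Finite.trans Λ N.obj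
  have := h1 E
  have := h1 M
  let f : (E ⟶ M) →ₗ[k] (E.obj →ₗ[k] M.obj) :=
    { toFun := fun g => g.hom.hom.restrictScalars k
      map_add' := fun _ _ => rfl
      map_smul' := fun _ _ => rfl }
  have hf : Function.Injective f := fun g g' h => by
    ext x
    exact LinearMap.congr_fun h x
  have : Module.Finite k (E ⟶ M) := Module.Finite.of_injective f hf
  have : IsScalarTower k (Aus E) (E ⟶ M) := ⟨fun c γ g =>
    Linear.smul_comp _ _ _ c γ.unop g⟩
  exact Module.Finite.of_restrictScalars_finite k (Aus E) (E ⟶ M)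

theorem finite_obj (k : Type*) [Field k] [Algebra k Λ] [Module.Finite k Λ]
    (f : Arrow (FGModuleCat.{u} Λ)) :
    ModuleCat.isFG (StableAus r) ((α E ⋙ q r).obj f) := by
  have h1 : Module.Finite (Aus E) ((preadditiveCoyonedaObj E).obj f.right) :=
    finite_hom k f.right
  have h2 : Module.Finite (Aus E) ((α E).obj f) :=
    Module.Finite.of_surjective (cokernel.π ((preadditiveCoyonedaObj E).map f.hom)).hom
      ((ModuleCat.epi_iff_surjective _).1 inferInstance)
  exact finite_balancedTensor _ _

/-- The functor `F = (Γ / ΓeΓ) ⊗_Γ α(-)` from `S(Λ)` to the finitely generated modules over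
`Γ / ΓeΓ`. The ground field `k` only serves to show that the values are finitely generated. -/
def F (k : Type*) [Field k] [Algebra k Λ] [Module.Finite k Λ] :
    Sub Λ ⥤ FGModuleCat.{u} (StableAus r) :=
  ObjectProperty.lift _ (η ⋙ α E ⋙ q r) fun X => finite_obj r k (η.obj X)

/-- The functor `G = (Γ / ΓeΓ) ⊗_Γ α(ε(-))` from `S(Λ)` to the finitely generated modules over
`Γ / ΓeΓ`. -/
def G (k : Type*) [Field k] [Algebra k Λ] [Module.Finite k Λ] :
    Sub Λ ⥤ FGModuleCat.{u} (StableAus r) :=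
  ObjectProperty.lift _ (ε ⋙ α E ⋙ q r) fun X => finite_obj r k (ε.obj X)

variable (E)

/-- The smallest additive subcategory of `S(Λ)` that contains `(E = E)` and all monomorphisms
`(M ⟶ I)` with `I` projective and injective. -/
def U : ObjectProperty (Sub Λ) :=
  additiveClosure fun X => X = Sub.mk (𝟙 E) ∨
    (Module.Projective Λ X.obj.right ∧ Module.Injective.{u, u} Λ X.obj.right)

/-- `add((E = E) ⊕ (0 ⟶ E))` in `S(Λ)`. -/
def V : ObjectProperty (Sub Λ) :=
  add (Sub.mk (𝟙 E) ⊞ Sub.mk (0 : zeroModule ⟶ E))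

end Auslander

end SubmoduleCategory

end

/-! Everything rests on a description of `(Γ/ΓeΓ) ⊗ α(-)` at `f : M₁ ⟶ M₀`: each element is the
class `cls` of some `h : E ⟶ M₀`, and by `cls_eq_zero_iff` this class is zero exactly when `h = u ≫
f + p` with `p` a sum of maps through `Λ`. As `E` generates, the identity of any module is a sum of
maps through `E`. Hence homomorphisms between values come from maps of targets
(`exists_hom_of_hom_obj`), and a map `g` killed on all of `Hom(E, -)` itself has the form `t ≫ f +
p` (`exists_eq_add_of_cls_eq_zero`).

For `F`, the term `t ≫ f` factors through an identity object, and `p` through a submodule of a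
projective-injective, so the kernel of `F` consists of maps through `U`. Fullness holds because `Λ`
is injective, so `p` extends along monomorphisms. For density, a presentation `g : M₁ ⟶ M₀` is made
mono by adding an embedding `M₁ ⟶ I` as a second component, which does not change the value. For `G`
the dual arguments with cokernels apply: `p` lifts along epimorphisms because `Λ` is projective, and
`g` is made epi by adding a projective `P ⟶ M₀`.

The embeddings `M ⟶ I` exist because every simple module embeds into `Λ`
(`exists_ne_zero_of_simple`). The count uses local endomorphism rings: an indecomposable of `U` or
`V` is a retract of a single generator. Those of `V` are `(M = M)` and `(0 ⟶ M)`. Those of `U` are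
`(M = M)` together with one further object for each `M`: the minimal embedding into a
projective-injective, or `(0 ⟶ M)` if `M` is projective-injective. -/

noncomputable section

namespace SubmoduleCategory

/-! ### Ideals of morphisms through a class of objects. -/

section FactorSubgroup

variable {C : Type*} [Category* C] [Preadditive C]

/-- The group of sums of morphisms that factor through an object satisfying `P`. -/
def factorSubgroup (P : ObjectProperty C) (X Y : C) : AddSubgroup (X ⟶ Y) :=
  AddSubgroup.closure {g | ∃ (Z : C) (a : X ⟶ Z) (b : Z ⟶ Y), P Z ∧ g = a ≫ b}

variable {P : ObjectProperty C} {X Y Z : C}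

theorem comp_mem_factorSubgroup (hZ : P Z) (a : X ⟶ Z) (b : Z ⟶ Y) :
    a ≫ b ∈ factorSubgroup P X Y :=
  AddSubgroup.subset_closure ⟨Z, a, b, hZ, rfl⟩

/-- Induction principle for `factorSubgroup`: the two properties `0` and negation come for free
when the predicate is stable under sums and contains all factoring morphisms. -/
theorem factorSubgroup_induction {p : (X ⟶ Y) → Prop}
    (comp : ∀ (Z : C) (a : X ⟶ Z) (b : Z ⟶ Y), P Z → p (a ≫ b))
    (zero : p 0) (add : ∀ f g, p f → p g → p (f + g))
    {f : X ⟶ Y} (hf : f ∈ factorSubgroup P X Y) : p f := by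
  refine AddSubgroup.closure_induction (p := fun f _ => p f ∧ p (-f)) ?_ ?_ ?_ ?_ hf |>.1
  · rintro _ ⟨Z, a, b, hZ, rfl⟩
    exact ⟨comp Z a b hZ, by simpa using comp Z (-a) b hZ⟩
  · simpa using zero
  · rintro f g - - ⟨hf, hf'⟩ ⟨hg, hg'⟩
    exact ⟨add _ _ hf hg, by rw [neg_add]; exact add _ _ hf' hg'⟩
  · rintro f - ⟨hf, hf'⟩
    exact ⟨hf', by simpa using hf⟩

theorem comp_left_mem_factorSubgroup (f : X ⟶ Y) {g : Y ⟶ Z} (hg : g ∈ factorSubgroup P Y Z) :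
    f ≫ g ∈ factorSubgroup P X Z := by
  refine factorSubgroup_induction (p := fun g => f ≫ g ∈ factorSubgroup P X Z) ?_ ?_ ?_ hg
  · intro W a b hW
    rw [← Category.assoc]
    exact comp_mem_factorSubgroup hW _ _
  · simp [zero_mem]
  · intro g g' h h'
    rw [Preadditive.comp_add]
    exact add_mem h h'

theorem comp_right_mem_factorSubgroup {f : X ⟶ Y} (g : Y ⟶ Z) (hf : f ∈ factorSubgroup P X Y) :
    f ≫ g ∈ factorSubgroup P X Z := by
  refine factorSubgroup_induction (p := fun f => f ≫ g ∈ factorSubgroup P X Z) ?_ ?_ ?_ hf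
  · intro W a b hW
    rw [Category.assoc]
    exact comp_mem_factorSubgroup hW _ _
  · simp [zero_mem]
  · intro g g' h h'
    rw [Preadditive.add_comp]
    exact add_mem h h'

/-- Stands in for an explicit description of `additiveClosure P`: having an identity that is a sum
of maps through `P` is stable under sums and summands, so it holds on the whole closure. -/
theorem isAdditiveSubcategory_id_mem_factorSubgroup (P : ObjectProperty C) :
    IsAdditiveSubcategory fun X : C => 𝟙 X ∈ factorSubgroup P X X where
  zero X hX := by rw [hX.eq_of_src (𝟙 X) 0]; exact zero_mem _
  directSum X Y b := by
    rintro ⟨hb⟩ hX hY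
    rw [← IsBilimit.binary_total hb]
    exact add_mem
      (comp_left_mem_factorSubgroup _ (by simpa using comp_right_mem_factorSubgroup b.inl hX))
      (comp_left_mem_factorSubgroup _ (by simpa using comp_right_mem_factorSubgroup b.inr hY))
  summand X Y b _ h := by
    have := comp_left_mem_factorSubgroup b.inl (comp_right_mem_factorSubgroup b.fst h)
    simpa using this

theorem id_mem_factorSubgroup_of_additiveClosure (h : additiveClosure P X) :
    𝟙 X ∈ factorSubgroup P X X :=
  h _ (isAdditiveSubcategory_id_mem_factorSubgroup P) fun Y hY => by
    simpa using comp_mem_factorSubgroup hY (𝟙 Y) (𝟙 Y)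

theorem subset_additiveClosure : P ≤ additiveClosure P := fun _ h _ _ hQ => hQ _ h

theorem isAdditiveSubcategory_additiveClosure (P : ObjectProperty C) :
    IsAdditiveSubcategory (additiveClosure P) where
  zero X hX _ hQ _ := hQ.zero X hX
  directSum X Y b hb hX hY Q hQ hP := hQ.directSum X Y b hb (hX Q hQ hP) (hY Q hQ hP)
  summand X Y b hb h Q hQ hP := hQ.summand X Y b hb (h Q hQ hP)

end FactorSubgroup

/-! ### Local endomorphism rings and indecomposable objects. -/

section Local

/-- Fitting's lemma, carried out in the commutative artinian subalgebra generated by `a`. -/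
theorem isNilpotent_or_isUnit_of_finite (k : Type*) [Field k] {A : Type*} [Ring A] [Algebra k A]
    [Module.Finite k A] (h : ∀ e : A, e * e = e → e = 0 ∨ e = 1) (a : A) :
    IsNilpotent a ∨ IsUnit a := by
  let S := Algebra.adjoin k {a}
  have := Algebra.isMulCommutative_adjoin k (s := {a}) (by
    rintro x hx y hy
    rw [Set.mem_singleton_iff.1 hx, Set.mem_singleton_iff.1 hy])
  let _ : CommRing S := inferInstance
  have : Module.Finite k S := Module.Finite.of_injective S.val.toLinearMap Subtype.val_injective
  have : IsArtinianRing S := IsArtinianRing.of_finite k S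
  let x : S := ⟨a, Algebra.self_mem_adjoin_singleton k a⟩
  -- The chain of ideals `(x ^ n)` stabilises, so `x ^ (n + 1) * y = x ^ n`. Iterating `n` times
  -- makes `x ^ n * y ^ n` idempotent.
  obtain ⟨n, y, hy⟩ := IsArtinian.exists_pow_succ_smul_dvd x (1 : S)
  simp only [smul_eq_mul, mul_one] at hy
  have key : ∀ m, x ^ (n + m) * y ^ m = x ^ n := by
    intro m
    induction m with
    | zero => simp
    | succ m ih =>
      calc x ^ (n + (m + 1)) * y ^ (m + 1) = (x ^ (n + 1) * y) * x ^ m * y ^ m := by ring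
        _ = x ^ (n + m) * y ^ m := by
          rw [show x ^ (n + 1) * y = x ^ n from hy]; ring
        _ = _ := ih
  have hn := key n
  have hidem : (x ^ n * y ^ n) * (x ^ n * y ^ n) = x ^ n * y ^ n := by
    calc _ = (x ^ (n + n) * y ^ n) * y ^ n := by ring
      _ = _ := by rw [hn]
  have h0 := h (x ^ n * y ^ n : S) (by exact_mod_cast congrArg Subtype.val hidem)
  rcases h0 with h0 | h1
  · left
    refine ⟨n, ?_⟩
    have h0' : x ^ n * y ^ n = 0 := Subtype.ext h0
    have : x ^ n = 0 := by
      calc x ^ n = x ^ (n + n) * y ^ n := hn.symm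
        _ = x ^ n * (x ^ n * y ^ n) := by ring
        _ = 0 := by rw [h0', mul_zero]
    exact congrArg Subtype.val this
  · right
    have h1' : x ^ n * y ^ n = 1 := Subtype.ext h1
    have hx : IsUnit x := by
      -- For `n = 0` the equation `h1'` says nothing, but `hy` reads `x * y = 1`.
      rcases Nat.eq_zero_or_pos n with rfl | hpos
      · refine IsUnit.of_mul_eq_one y ?_
        simpa using hy
      · exact isUnit_of_dvd_one ((dvd_pow_self x hpos.ne').trans ⟨_, h1'.symm⟩)
    exact hx.map S.val

variable {C : Type*} [Category* C] [Preadditive C]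

theorem IsNilpotent.isUnit_of_add {A : Type*} [Ring A] (h : ∀ a : A, IsNilpotent a ∨ IsUnit a)
    {a b : A} (hab : IsUnit (a + b)) : IsUnit a ∨ IsUnit b := by
  obtain ⟨u, hu⟩ := hab
  have e : (↑u⁻¹ * a) + ↑u⁻¹ * b = 1 := by rw [← mul_add, ← hu, Units.inv_mul]
  rcases h (↑u⁻¹ * a) with h1 | h1
  · right
    have : IsUnit (↑u⁻¹ * b : A) := by
      rw [show (↑u⁻¹ * b : A) = 1 - ↑u⁻¹ * a by rw [← e]; abel]
      exact h1.isUnit_one_sub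
    simpa using this
  · left; simpa using h1

/-- An object with local endomorphism ring is a retract of any object in a family through which
its identity factors additively. -/
theorem exists_retract_of_id_mem_factorSubgroup {P : ObjectProperty C} {X : C}
    (hX : ¬ IsZero X) (h : ∀ a : End X, IsNilpotent a ∨ IsUnit a)
    (hP : 𝟙 X ∈ factorSubgroup P X X) : ∃ Z, P Z ∧ Nonempty (Retract X Z) := by
  -- The identity is replaced by an arbitrary unit so that induction on sums applies: in a local
  -- ring one summand of a unit is a unit.
  have key : ∀ g ∈ factorSubgroup P X X, IsUnit (End.of g) →
      ∃ Z, P Z ∧ Nonempty (Retract X Z) := by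
    intro g hg
    refine factorSubgroup_induction (p := fun g => IsUnit (End.of g) →
      ∃ Z, P Z ∧ Nonempty (Retract X Z)) ?_ ?_ ?_ hg
    · intro Z a b hZ hu
      have : IsIso (a ≫ b) := (isUnit_iff_isIso _).1 hu
      exact ⟨Z, hZ, ⟨⟨a, b ≫ inv (a ≫ b), by rw [← Category.assoc]; simp⟩⟩⟩
    · intro hu
      have : IsIso (0 : X ⟶ X) := (isUnit_iff_isIso _).1 hu
      exact (hX ((IsZero.iff_id_eq_zero X).2 (by
        rw [← IsIso.hom_inv_id (0 : X ⟶ X), zero_comp]))).elim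
    · intro f g hf hg hu
      rcases IsNilpotent.isUnit_of_add h (a := End.of f) (b := End.of g) hu with h1 | h1
      · exact hf h1
      · exact hg h1
  exact key _ hP (isUnit_one (M := End X))

/-- The images of `e` and `𝟙 X - e` are complementary summands; conversely a decomposition gives the
projection onto its first summand. -/
theorem indecomposable_iff [HasBinaryBiproducts C] [IsIdempotentComplete C] {X : C} :
    Indecomposable X ↔ ¬ IsZero X ∧ ∀ e : X ⟶ X, e ≫ e = e → e = 0 ∨ e = 𝟙 X := by
  constructor
  · rintro ⟨h0, h⟩
    refine ⟨h0, fun e he => ?_⟩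
    obtain ⟨Y, i, p, hip, hpi⟩ := IsIdempotentComplete.idempotents_split X e he
    obtain ⟨Z, j, q, hjq, hqj⟩ := IsIdempotentComplete.idempotents_split X (𝟙 X - e)
      (by simp [he])
    have hiq : i ≫ q = 0 := by
      have : Mono j := mono_of_mono_fac hjq
      rw [← cancel_mono j, Category.assoc, hqj, zero_comp, Preadditive.comp_sub, ← hpi,
        reassoc_of% hip, Category.comp_id, sub_self]
    have hjp : j ≫ p = 0 := by
      have : Mono i := mono_of_mono_fac hip
      have : j = j ≫ (𝟙 X - e) := by rw [← hqj, reassoc_of% hjq]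
      rw [← cancel_mono i, Category.assoc, hpi, zero_comp, this, Category.assoc,
        Preadditive.sub_comp, he]
      simp
    rcases h Y Z ⟨biprod.lift p q, biprod.desc i j, by simp [hpi, hqj],
      by ext <;> simp [hip, hjq, hiq, hjp]⟩ with hY | hZ
    · left; rw [← hpi, hY.eq_of_src i 0, comp_zero]
    · right
      have : 𝟙 X - e = 0 := by rw [← hqj, hZ.eq_of_src j 0, comp_zero]
      exact (sub_eq_zero.1 this).symm
  · rintro ⟨h0, h⟩
    refine ⟨h0, fun Y Z φ => ?_⟩
    rcases h (φ.hom ≫ biprod.fst ≫ biprod.inl ≫ φ.inv) (by simp) with h1 | h1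
    · left
      have := congrArg (fun t => biprod.inl ≫ φ.inv ≫ t ≫ φ.hom ≫ biprod.fst) h1
      exact (IsZero.iff_id_eq_zero Y).2 (by simpa using this)
    · right
      have := congrArg (fun t => biprod.inr ≫ φ.inv ≫ t ≫ φ.hom ≫ biprod.snd) h1
      exact (IsZero.iff_id_eq_zero Z).2 (by simpa using this.symm)

theorem nonempty_iso_of_retract {X Y : C} (r : Retract X Y) (hX : ¬ IsZero X)
    (hY : ∀ e : Y ⟶ Y, e ≫ e = e → e = 0 ∨ e = 𝟙 Y) : Nonempty (X ≅ Y) := by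
  rcases hY (r.r ≫ r.i) (by simp) with h | h
  · refine (hX ((IsZero.iff_id_eq_zero X).2 ?_)).elim
    have := congrArg (fun t => r.i ≫ t ≫ r.r) h
    simpa using this
  · exact ⟨⟨r.i, r.r, r.retract, h⟩⟩

theorem isNilpotent_or_isUnit_of_indecomposable (k : Type*) [Field k] [Linear k C]
    [HasBinaryBiproducts C] [IsIdempotentComplete C] {X : C} [Module.Finite k (X ⟶ X)]
    (hX : Indecomposable X) (a : End X) : IsNilpotent a ∨ IsUnit a := by
  have : Module.Finite k (End X) := inferInstanceAs (Module.Finite k (X ⟶ X))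
  exact isNilpotent_or_isUnit_of_finite k
    (fun e he => (indecomposable_iff.1 hX).2 e.asHom (congrArg End.asHom he)) a

/-- If `a : X ⟶ X` restricts to the identity on a nonzero morphism into `X`, it is invertible. -/
theorem isIso_of_comp_eq {X Y : C} (h : ∀ a : End X, IsNilpotent a ∨ IsUnit a)
    {i : Y ⟶ X} (hi : i ≠ 0) {a : X ⟶ X} (ha : i ≫ a = i) : IsIso a := by
  rcases h (End.of a) with ⟨n, hn⟩ | hu
  · have key : ∀ n : ℕ, i ≫ ((End.of a) ^ n).asHom = i := by
      intro n
      induction n with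
      | zero => exact Category.comp_id i
      | succ n ih =>
        rw [pow_succ']
        change i ≫ (((End.of a) ^ n).asHom ≫ a) = i
        rw [← Category.assoc, ih, ha]
    have := key n
    rw [hn] at this
    exact (hi (this.symm.trans comp_zero)).elim
  · exact (isUnit_iff_isIso _).1 hu

end Local

/-! ### Equivalences induced on additive quotients. -/

section Quotient

variable {C D : Type*} [Category* C] [Category* D] [Preadditive C] [Preadditive D]

/-- An additive full and dense functor induces an equivalence if it kills the objects in `P` and
the morphisms that it kills factor through an object in `P`. -/
theorem inducesEquivalence_of (P : ObjectProperty C) (F : C ⥤ D) [F.Additive] [F.EssSurj]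
    [F.Full] (h0 : ∀ X, P X → IsZero (F.obj X))
    (h : ∀ (X Y : C) (f : X ⟶ Y), F.map f = 0 → ∃ (Z : C) (a : X ⟶ Z) (b : Z ⟶ Y),
      P Z ∧ f = a ≫ b) : InducesEquivalence P F := by
  have hr : ∀ (X Y : C) (f g : X ⟶ Y), factorsRel P f g → F.map f = F.map g := by
    rintro X Y f g ⟨Z, a, b, hZ, e⟩
    rw [← sub_eq_zero, ← F.map_sub, e, F.map_comp, (h0 Z hZ).eq_of_src (F.map b) 0, comp_zero]
  refine ⟨hr, ?_⟩
  have : (CategoryTheory.Quotient.lift (factorsRel P) F hr).Faithful := ⟨by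
    rintro ⟨X⟩ ⟨Y⟩ f g hfg
    obtain ⟨f, rfl⟩ := (CategoryTheory.Quotient.functor (factorsRel P)).map_surjective f
    obtain ⟨g, rfl⟩ := (CategoryTheory.Quotient.functor (factorsRel P)).map_surjective g
    refine CategoryTheory.Quotient.sound _ (h X Y (f - g) ?_)
    rw [F.map_sub, sub_eq_zero]
    exact hfg⟩
  have : (CategoryTheory.Quotient.lift (factorsRel P) F hr).Full := ⟨by
    rintro ⟨X⟩ ⟨Y⟩ f
    obtain ⟨g, hg⟩ := F.map_surjective f
    exact ⟨(CategoryTheory.Quotient.functor (factorsRel P)).map g, hg⟩⟩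
  have : (CategoryTheory.Quotient.lift (factorsRel P) F hr).EssSurj := ⟨fun Y =>
    ⟨⟨F.objPreimage Y⟩, ⟨F.objObjPreimageIso Y⟩⟩⟩
  exact {}

theorem isAdditiveSubcategory_isZero_obj (F : C ⥤ D) [F.Additive] :
    IsAdditiveSubcategory fun X => IsZero (F.obj X) where
  zero X hX := F.map_isZero hX
  directSum X Y b := by
    rintro ⟨hb⟩ hX hY
    refine (IsZero.iff_id_eq_zero _).2 ?_
    rw [← F.map_id, ← IsBilimit.binary_total hb, F.map_add, F.map_comp, F.map_comp,
      hX.eq_of_src (F.map b.inl) 0, hY.eq_of_src (F.map b.inr) 0]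
    simp
  summand X Y b _ h := by
    refine (IsZero.iff_id_eq_zero _).2 ?_
    rw [← F.map_id, ← b.inl_fst, F.map_comp, h.eq_of_src (F.map b.fst) 0, comp_zero]

/-- Transports `hgen` along an additive functor: once the image of `E` lies in `P`, so does the
image of every module. -/
theorem isAdditiveSubcategory_obj (F : C ⥤ D) [F.Additive] {P : ObjectProperty D}
    (hP : IsAdditiveSubcategory P) : IsAdditiveSubcategory fun X => P (F.obj X) where
  zero X hX := hP.zero _ (F.map_isZero hX)
  directSum X Y b := by
    rintro ⟨hb⟩ hX hY
    exact hP.directSum _ _ (F.mapBinaryBicone b) ⟨isBinaryBilimitOfTotal _ (by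
      have := congrArg F.map (IsBilimit.binary_total hb)
      rw [F.map_id, F.map_add, F.map_comp, F.map_comp] at this
      exact this)⟩ hX hY
  summand X Y b := by
    rintro ⟨hb⟩ h
    exact hP.summand _ _ (F.mapBinaryBicone b) ⟨isBinaryBilimitOfTotal _ (by
      have := congrArg F.map (IsBilimit.binary_total hb)
      rw [F.map_id, F.map_add, F.map_comp, F.map_comp] at this
      exact this)⟩ h

end Quotient

/-! ### Finitely generated modules, projective-injectives, and maps through projectives. -/

section ModuleLemmas

variable {Λ : Type u} [Ring Λ]

theorem injective_of_mono {M N : FGModuleCat.{u} Λ} (f : M ⟶ N) [Mono f] :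
    Function.Injective f.hom.hom := by
  rw [injective_iff_map_eq_zero]
  intro x hx
  let g : FGModuleCat.of Λ Λ ⟶ M := ⟨ModuleCat.ofHom (LinearMap.toSpanSingleton Λ M x)⟩
  have h : g ≫ f = 0 ≫ f := by
    rw [zero_comp]
    refine FGModuleCat.hom_ext (LinearMap.ext_ring ?_)
    exact (congrArg f.hom.hom (one_smul Λ x)).trans hx
  have := congrArg (fun t : FGModuleCat.of Λ Λ ⟶ M => t.hom.hom (1 : Λ)) ((cancel_mono f).1 h)
  exact (one_smul Λ x).symm.trans this

theorem mono_of_injective {M N : FGModuleCat.{u} Λ} (f : M ⟶ N)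
    (h : Function.Injective f.hom.hom) : Mono f :=
  ⟨fun _ _ e => FGModuleCat.hom_ext (LinearMap.ext fun x => h
    (LinearMap.congr_fun (congrArg (fun t => t.hom.hom) e) x))⟩

theorem epi_of_surjective {M N : FGModuleCat.{u} Λ} (f : M ⟶ N)
    (h : Function.Surjective f.hom.hom) : Epi f :=
  ⟨fun _ _ e => FGModuleCat.hom_ext (LinearMap.ext fun x => by
    obtain ⟨x, rfl⟩ := h x
    exact LinearMap.congr_fun (congrArg (fun t => t.hom.hom) e) x)⟩

theorem surjective_of_epi {M N : FGModuleCat.{u} Λ} (f : M ⟶ N) [Epi f] :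
    Function.Surjective f.hom.hom := by
  let g : N ⟶ FGModuleCat.of Λ (N ⧸ LinearMap.range f.hom.hom) :=
    ⟨ModuleCat.ofHom (LinearMap.range f.hom.hom).mkQ⟩
  have h : f ≫ g = f ≫ 0 := by
    refine FGModuleCat.hom_ext (LinearMap.ext fun x => ?_)
    exact (Submodule.Quotient.mk_eq_zero _).2 ⟨x, rfl⟩
  intro y
  have := congrArg (fun t => t.hom.hom y) ((cancel_epi f).1 h)
  exact (Submodule.Quotient.mk_eq_zero _).1 this

theorem isIso_of_bijective {M N : FGModuleCat.{u} Λ} (f : M ⟶ N)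
    (h : Function.Bijective f.hom.hom) : IsIso f :=
  ⟨⟨⟨ModuleCat.ofHom (LinearEquiv.ofBijective f.hom.hom h).symm.toLinearMap⟩,
    FGModuleCat.hom_ext (LinearMap.ext fun x =>
      (LinearEquiv.ofBijective f.hom.hom h).symm_apply_apply x),
    FGModuleCat.hom_ext (LinearMap.ext fun x =>
      (LinearEquiv.ofBijective f.hom.hom h).apply_symm_apply x)⟩⟩

theorem isZero_of_subsingleton (M : FGModuleCat.{u} Λ) [Subsingleton M] : IsZero M :=
  (IsZero.iff_id_eq_zero M).2 (FGModuleCat.hom_ext (LinearMap.ext fun _ => Subsingleton.elim _ _))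

variable (Λ) in
theorem isZero_zeroModule : IsZero (zeroModule : FGModuleCat.{u} Λ) :=
  have : Subsingleton (zeroModule : FGModuleCat.{u} Λ) :=
    inferInstanceAs (Subsingleton PUnit.{u + 1})
  isZero_of_subsingleton _

/-- The morphisms between finitely generated modules that factor through projective modules. -/
abbrev projSubgroup (X Y : FGModuleCat.{u} Λ) : AddSubgroup (X ⟶ Y) :=
  factorSubgroup (fun Z => Z = FGModuleCat.of Λ Λ) X Y

theorem comp_mem_projSubgroup {X Y : FGModuleCat.{u} Λ} (a : X ⟶ FGModuleCat.of Λ Λ)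
    (b : FGModuleCat.of Λ Λ ⟶ Y) : a ≫ b ∈ projSubgroup X Y :=
  comp_mem_factorSubgroup (P := fun Z => Z = FGModuleCat.of Λ Λ) rfl a b

theorem projSubgroup_induction {X Y : FGModuleCat.{u} Λ} {p : (X ⟶ Y) → Prop}
    (comp : ∀ (a : X ⟶ FGModuleCat.of Λ Λ) (b : FGModuleCat.of Λ Λ ⟶ Y), p (a ≫ b))
    (zero : p 0) (add : ∀ f g, p f → p g → p (f + g))
    {f : X ⟶ Y} (hf : f ∈ projSubgroup X Y) : p f :=
  factorSubgroup_induction (fun Z a b hZ => by subst hZ; exact comp a b) zero add hf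

theorem id_mem_projSubgroup (P : FGModuleCat.{u} Λ) [Module.Projective Λ P] :
    𝟙 P ∈ projSubgroup P P := by
  obtain ⟨n, f, hf⟩ := Module.Finite.exists_fin' Λ P
  obtain ⟨s, hs⟩ := Module.projective_lifting_property f LinearMap.id hf
  let a (i : Fin n) : P ⟶ FGModuleCat.of Λ Λ := ⟨ModuleCat.ofHom (LinearMap.proj i ∘ₗ s)⟩
  let b (i : Fin n) : FGModuleCat.of Λ Λ ⟶ P :=
    ⟨ModuleCat.ofHom (f ∘ₗ LinearMap.single Λ (fun _ => Λ) i)⟩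
  have : 𝟙 P = ∑ i : Fin n, a i ≫ b i := by
    refine FGModuleCat.hom_ext (LinearMap.ext fun x => ?_)
    let ev : (P ⟶ P) →+ P :=
      AddMonoidHom.mk' (fun g => g.hom.hom x) fun _ _ => rfl
    have key : ev (∑ i : Fin n, a i ≫ b i) = ∑ i, f (Pi.single i (s x i)) := map_sum ev _ _
    refine Eq.trans ?_ key.symm
    rw [← map_sum, Finset.univ_sum_single]
    exact (LinearMap.congr_fun hs x).symm
  rw [this]
  exact sum_mem fun i _ => comp_mem_projSubgroup _ _

theorem projective_of_moduleProjective (P : FGModuleCat.{u} Λ) [Module.Projective Λ P] :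
    Projective P where
  factors f e he := by
    obtain ⟨s, hs⟩ := Module.projective_lifting_property e.hom.hom f.hom.hom (surjective_of_epi e)
    exact ⟨⟨ModuleCat.ofHom s⟩, FGModuleCat.hom_ext hs⟩

theorem moduleProjective_of_projective (P : FGModuleCat.{u} Λ) [Projective P] :
    Module.Projective Λ P := by
  obtain ⟨n, f, hf⟩ := Module.Finite.exists_fin' Λ P
  let f' : FGModuleCat.of Λ (ULift.{u} (Fin n) → Λ) ⟶ P :=
    ⟨ModuleCat.ofHom (f ∘ₗ (LinearEquiv.funCongrLeft Λ Λ Equiv.ulift.{u}.symm).toLinearMap)⟩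
  have : Epi f' := epi_of_surjective _ (hf.comp (LinearEquiv.surjective _))
  refine Module.Projective.of_split (M := ULift.{u} (Fin n) → Λ)
    (Projective.factorThru (𝟙 P) f').hom.hom f'.hom.hom ?_
  exact congrArg (fun t => t.hom.hom) (Projective.factorThru_comp (𝟙 P) f')

theorem injective_of_moduleInjective (I : FGModuleCat.{u} Λ) (h : Module.Injective.{u, u} Λ I) :
    Injective I where
  factors g f hf := by
    obtain ⟨s, hs⟩ := h.out f.hom.hom (injective_of_mono f) g.hom.hom
    exact ⟨⟨ModuleCat.ofHom s⟩, FGModuleCat.hom_ext (LinearMap.ext hs)⟩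

/-- By Baer's criterion only left ideals need testing, and these are finitely generated over a
noetherian ring. -/
theorem moduleInjective_of_injective [IsNoetherianRing Λ] (I : FGModuleCat.{u} Λ) [Injective I] :
    Module.Injective.{u, u} Λ I := by
  refine Module.Baer.injective fun J g => ?_
  let ι : FGModuleCat.of Λ J ⟶ FGModuleCat.of Λ Λ := ⟨ModuleCat.ofHom J.subtype⟩
  have : Mono ι := mono_of_injective _ Subtype.val_injective
  let g' : FGModuleCat.of Λ J ⟶ I := ⟨ModuleCat.ofHom g⟩
  refine ⟨(Injective.factorThru g' ι).hom.hom, fun x hx => ?_⟩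
  exact LinearMap.congr_fun (congrArg (fun t => t.hom.hom) (Injective.comp_factorThru g' ι)) ⟨x, hx⟩

/-- A finitely generated module that is both projective and injective. -/
def IsProjInj (M : FGModuleCat.{u} Λ) : Prop := Projective M ∧ Injective M

theorem isProjInj_iff [IsNoetherianRing Λ] (M : FGModuleCat.{u} Λ) :
    IsProjInj M ↔ Module.Projective Λ M ∧ Module.Injective.{u, u} Λ M :=
  ⟨fun ⟨_, _⟩ => ⟨moduleProjective_of_projective M, moduleInjective_of_injective M⟩,
    fun ⟨_, h⟩ => ⟨projective_of_moduleProjective M, injective_of_moduleInjective M h⟩⟩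

theorem IsProjInj.of_retract {M N : FGModuleCat.{u} Λ} (r : Retract M N) (h : IsProjInj N) :
    IsProjInj M :=
  have := h.1
  have := h.2
  ⟨r.projective, r.injective⟩

theorem IsProjInj.biprod {M N : FGModuleCat.{u} Λ} (hM : IsProjInj M) (hN : IsProjInj N) :
    IsProjInj (M ⊞ N) := by
  obtain ⟨_, _⟩ := hM
  obtain ⟨_, _⟩ := hN
  exact ⟨inferInstance, inferInstance⟩

/-- A morphism in `projSubgroup` factors through a single projective-injective module. -/
theorem exists_factor_isProjInj (hΛ : IsProjInj (FGModuleCat.of Λ Λ)) {X Y : FGModuleCat.{u} Λ}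
    {f : X ⟶ Y} (hf : f ∈ projSubgroup X Y) :
    ∃ (P : FGModuleCat.{u} Λ) (a : X ⟶ P) (b : P ⟶ Y), IsProjInj P ∧ f = a ≫ b := by
  refine projSubgroup_induction (p := fun f => ∃ (P : FGModuleCat.{u} Λ) (a : X ⟶ P)
    (b : P ⟶ Y), IsProjInj P ∧ f = a ≫ b) ?_ ?_ ?_ hf
  · intro a b
    exact ⟨_, a, b, hΛ, rfl⟩
  · exact ⟨_, 0, 0, hΛ, by simp⟩
  · rintro f g ⟨P, a, b, hP, rfl⟩ ⟨P', a', b', hP', rfl⟩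
    exact ⟨P ⊞ P', biprod.lift a a', biprod.desc b b', hP.biprod hP', by simp⟩

/-- Maps into the injective module `Λ` extend along `i`. This is what self-injectivity contributes
to the fullness of `F`. -/
theorem exists_extension_mem_projSubgroup (hΛ : IsProjInj (FGModuleCat.of Λ Λ))
    {X Y Z : FGModuleCat.{u} Λ} (i : X ⟶ Y) [Mono i] {f : X ⟶ Z} (hf : f ∈ projSubgroup X Z) :
    ∃ g ∈ projSubgroup Y Z, f = i ≫ g := by
  have := hΛ.2
  refine projSubgroup_induction (p := fun f => ∃ g ∈ projSubgroup Y Z, f = i ≫ g) ?_ ?_ ?_ hf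
  · intro a b
    exact ⟨Injective.factorThru a i ≫ b, comp_mem_projSubgroup _ _, by simp⟩
  · exact ⟨0, zero_mem _, by simp⟩
  · rintro _ _ ⟨g, hg, rfl⟩ ⟨g', hg', rfl⟩
    exact ⟨g + g', add_mem hg hg', by simp⟩

/-- Maps out of `Λ` lift along `p`. This serves `G` as the preceding extension lemma serves `F`,
without self-injectivity. -/
theorem exists_lift_mem_projSubgroup {X Y Z : FGModuleCat.{u} Λ} (p : Y ⟶ Z) [Epi p] {f : X ⟶ Z}
    (hf : f ∈ projSubgroup X Z) : ∃ g ∈ projSubgroup X Y, f = g ≫ p := by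
  have : Projective (FGModuleCat.of Λ Λ) :=
    have : Module.Projective Λ (FGModuleCat.of Λ Λ) := inferInstanceAs (Module.Projective Λ Λ)
    projective_of_moduleProjective _
  refine projSubgroup_induction (p := fun f => ∃ g ∈ projSubgroup X Y, f = g ≫ p) ?_ ?_ ?_ hf
  · intro a b
    exact ⟨a ≫ Projective.factorThru b p, comp_mem_projSubgroup _ _, by simp⟩
  · exact ⟨0, zero_mem _, by simp⟩
  · rintro _ _ ⟨g, hg, rfl⟩ ⟨g', hg', rfl⟩
    exact ⟨g + g', add_mem hg hg', by simp⟩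

end ModuleLemmas

/-! ### Finite-dimensional Hom spaces. -/

section FiniteHom

variable (k : Type*) [Field k] {Λ : Type u} [Ring Λ] [Algebra k Λ] [Module.Finite k Λ]

open ModuleCat in
instance finite_hom_field (M N : FGModuleCat.{u} Λ) : Module.Finite k (M ⟶ N) := by
  have h1 : ∀ N : FGModuleCat.{u} Λ, Module.Finite k N.obj := fun N =>
    have : Module.Finite Λ N.obj := N.property
    Module.Finite.trans Λ N.obj
  have := h1 M
  have := h1 N
  let f : (M ⟶ N) →ₗ[k] (M.obj →ₗ[k] N.obj) :=
    { toFun := fun g => g.hom.hom.restrictScalars k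
      map_add' := fun _ _ => rfl
      map_smul' := fun _ _ => rfl }
  have hf : Function.Injective f := fun g g' h => by
    ext x
    exact LinearMap.congr_fun h x
  exact Module.Finite.of_injective f hf

end FiniteHom

/-! ### Simple modules. -/

section Simple

variable {Λ : Type u} [Ring Λ]

theorem simple_of_isSimpleModule (S : FGModuleCat.{u} Λ) [IsSimpleModule Λ S] : Simple S where
  mono_isIso_iff_nonzero {Y} f _ := by
    constructor
    · rintro _ rfl
      have hS : IsZero S := (IsZero.iff_id_eq_zero S).2 (by
        rw [← IsIso.inv_hom_id (0 : Y ⟶ S), comp_zero])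
      have : Subsingleton S := ⟨fun x y => by
        have h := fun x : S => congrArg (fun t => t.hom.hom x) ((IsZero.iff_id_eq_zero S).1 hS)
        exact (h x).trans (h y).symm⟩
      have : Nontrivial S := IsSimpleModule.nontrivial Λ S
      exact not_subsingleton _ ‹Subsingleton S›
    · intro hf
      refine isIso_of_bijective f ⟨injective_of_mono f, ?_⟩
      refine (LinearMap.surjective_or_eq_zero f.hom.hom).resolve_right fun h => hf ?_
      exact FGModuleCat.hom_ext h

theorem exists_simple_mono [IsArtinianRing Λ] (M : FGModuleCat.{u} Λ) (hM : ¬ IsZero M) :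
    ∃ (S : FGModuleCat.{u} Λ) (_ : Simple S) (i : S ⟶ M), Mono i := by
  have : Nontrivial M := by
    by_contra h
    rw [not_nontrivial_iff_subsingleton] at h
    exact hM (isZero_of_subsingleton M)
  obtain ⟨S, hS⟩ := IsAtomic.exists_atom (Submodule Λ M)
  have : IsSimpleModule Λ S := isSimpleModule_iff_isAtom.2 hS
  have : IsSimpleModule Λ (FGModuleCat.of Λ S) := this
  exact ⟨FGModuleCat.of Λ S, simple_of_isSimpleModule _, ⟨ModuleCat.ofHom S.subtype⟩,
    mono_of_injective _ Subtype.val_injective⟩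

end Simple

/-! ### Socles and tops of indecomposable projective-injectives. -/

section Socle

variable {C : Type*} [Category* C] [Abelian C]

/-- Two injective indecomposable objects with isomorphic simple subobjects are isomorphic. -/
theorem nonempty_iso_of_simple_mono {N N' S : C} [Simple S] [Injective N] [Injective N']
    (h : ∀ a : End N, IsNilpotent a ∨ IsUnit a) (h' : ∀ a : End N', IsNilpotent a ∨ IsUnit a)
    (i : S ⟶ N) (i' : S ⟶ N') (hi : i ≠ 0) (hi' : i' ≠ 0) : Nonempty (N ≅ N') := by
  have := mono_of_nonzero_from_simple hi
  have := mono_of_nonzero_from_simple hi'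
  let f := Injective.factorThru i' i
  let g := Injective.factorThru i i'
  have hf : i ≫ f = i' := Injective.comp_factorThru _ _
  have hg : i' ≫ g = i := Injective.comp_factorThru _ _
  -- Both composites restrict to the identity on `S`, so neither is nilpotent.
  have h1 : IsIso (f ≫ g) := isIso_of_comp_eq h hi (by rw [reassoc_of% hf, hg])
  have h2 : IsIso (g ≫ f) := isIso_of_comp_eq h' hi' (by rw [reassoc_of% hg, hf])
  have : IsSplitMono f := ⟨⟨⟨g ≫ inv (f ≫ g), by rw [← Category.assoc]; simp⟩⟩⟩
  have : Epi f := epi_of_epi_fac (f := g) (h := g ≫ f) rfl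
  have : IsIso f := isIso_of_epi_of_isSplitMono f
  exact ⟨asIso f⟩

/-- An indecomposable projective object has at most one simple quotient. -/
theorem nonempty_iso_of_simple_epi {N S S' : C} [Simple S] [Simple S'] [Projective N]
    (h : ∀ a : End N, IsNilpotent a ∨ IsUnit a) (p : N ⟶ S) (p' : N ⟶ S') (hp : p ≠ 0)
    (hp' : p' ≠ 0) : Nonempty (S ≅ S') := by
  have : Epi p := epi_of_nonzero_to_simple hp
  by_cases hz : kernel.ι p ≫ p' = 0
  · have hne : Abelian.epiDesc p p' hz ≠ 0 := by
      intro h0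
      apply hp'
      rw [← Abelian.comp_epiDesc p p' hz, h0, comp_zero]
    have := isIso_of_hom_simple hne
    exact ⟨asIso (Abelian.epiDesc p p' hz)⟩
  -- If `p'` is nonzero on `kernel p`, then `p'` lifts through that restriction. This gives an
  -- endomorphism of `N` that preserves `p'`, hence is not nilpotent and so invertible, yet is
  -- killed by `p`; thus `p = 0`.
  · exfalso
    have : Epi (kernel.ι p ≫ p') := epi_of_nonzero_to_simple hz
    let g := Projective.factorThru p' (kernel.ι p ≫ p')
    have hg : (g ≫ kernel.ι p) ≫ p' = p' := by
      rw [Category.assoc]; exact Projective.factorThru_comp _ _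
    have hiso : IsIso (g ≫ kernel.ι p) := by
      rcases h (End.of (g ≫ kernel.ι p)) with ⟨n, hn⟩ | hu
      · have key : ∀ n : ℕ, ((End.of (g ≫ kernel.ι p)) ^ n).asHom ≫ p' = p' := by
          intro n
          induction n with
          | zero => exact Category.id_comp p'
          | succ n ih =>
            rw [pow_succ]
            change ((g ≫ kernel.ι p) ≫ ((End.of (g ≫ kernel.ι p)) ^ n).asHom) ≫ p' = p'
            rw [Category.assoc, ih, hg]
        have := key n
        rw [hn] at this
        exact (hp' (this.symm.trans zero_comp)).elim
      · exact (isUnit_iff_isIso _).1 hu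
    apply hp
    rw [← cancel_epi (g ≫ kernel.ι p)]
    simp

/-- If a projective-injective generator is a finite direct sum of pairwise non-isomorphic
objects with local endomorphism rings, then every simple object embeds into it. -/
theorem exists_ne_zero_of_simple {n : ℕ} (N : Fin n → C)
    (hinj : ∀ i, Injective (N i)) (hproj : ∀ i, Projective (N i))
    (hloc : ∀ i, ∀ a : End (N i), IsNilpotent a ∨ IsUnit a)
    (hN : ∀ i j, Nonempty (N i ≅ N j) → i = j)
    (hsub : ∀ i, ∃ (S : C) (_ : Simple S) (f : S ⟶ N i), f ≠ 0)
    (hquot : ∀ (S : C) [Simple S], ∃ (i : Fin n) (f : N i ⟶ S), f ≠ 0)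
    (S : C) [Simple S] : ∃ (i : Fin n) (f : S ⟶ N i), f ≠ 0 := by
  choose T hT s hs using hsub
  -- The Nakayama permutation: `N (φ i)` has as top the simple `T i` in the socle of `N i`. It is
  -- injective because `T i ≅ T j` forces `N i ≅ N j`, hence surjective on a finite set, so every
  -- top is some `T i`.
  choose φ p hp using fun i => hquot (T i)
  have hφ : Function.Injective φ := by
    intro i j hij
    have key : ∀ (l : Fin n) (q : N l ⟶ T j) (_ : q ≠ 0), φ i = l → Nonempty (T i ≅ T j) := by
      rintro l q hq rfl
      exact nonempty_iso_of_simple_epi (hloc _) (p i) q (hp i) hq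
    obtain ⟨e⟩ := key _ (p j) (hp j) hij
    refine hN i j (nonempty_iso_of_simple_mono (hloc i) (hloc j) (s i) (e.hom ≫ s j) (hs i) ?_)
    intro h0
    exact hs j (by rw [← cancel_epi e.hom, h0, comp_zero])
  obtain ⟨j, q, hq⟩ := hquot S
  obtain ⟨i, rfl⟩ := Finite.surjective_of_injective hφ j
  obtain ⟨e⟩ := nonempty_iso_of_simple_epi (hloc _) (p i) q (hp i) hq
  refine ⟨i, e.inv ≫ s i, fun h0 => hs i ?_⟩
  rw [← cancel_epi e.inv, h0, comp_zero]

end Socle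

/-! ### Embeddings into projective-injective modules. -/

section Cogenerator

theorem isNoetherianRing_of_finite (k : Type*) [Field k] {Λ : Type u} [Ring Λ] [Algebra k Λ]
    [Module.Finite k Λ] : IsNoetherianRing Λ :=
  isNoetherian_of_tower k inferInstance

/-- Basicness makes the indecomposable summands of `Λ` pairwise non-isomorphic, as
`exists_ne_zero_of_simple` requires. Some summand maps nontrivially to a given simple because `Λ`
generates. -/
theorem exists_ne_zero_to_ring (k : Type*) [Field k] {Λ : Type u} [Ring Λ] [Algebra k Λ]
    [Module.Finite k Λ]
    (hbasic : IsBasic (FGModuleCat.of Λ Λ))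
    (hΛ : IsProjInj (FGModuleCat.of Λ Λ)) (S : FGModuleCat.{u} Λ) [Simple S] :
    ∃ f : S ⟶ FGModuleCat.of Λ Λ, f ≠ 0 := by
  have : IsNoetherianRing Λ := isNoetherianRing_of_finite k
  have : IsArtinianRing Λ := IsArtinianRing.of_finite k Λ
  obtain ⟨n, N, hN, hNN, ⟨e⟩⟩ := hbasic
  have hret (i) : Retract (N i) (FGModuleCat.of Λ Λ) :=
    ⟨biproduct.ι N i ≫ e.inv, e.hom ≫ biproduct.π N i, by simp⟩
  obtain ⟨i, f, hf⟩ := exists_ne_zero_of_simple N (fun i => (hΛ.of_retract (hret i)).2)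
    (fun i => (hΛ.of_retract (hret i)).1)
    (fun i => isNilpotent_or_isUnit_of_indecomposable k (hN i)) hNN
    (fun i => by
      obtain ⟨S, hS, f, hf⟩ := exists_simple_mono (N i) (hN i).1
      refine ⟨S, hS, f, ?_⟩
      rintro rfl
      exact Simple.not_isZero S ((IsZero.iff_id_eq_zero S).2 (by
        rw [← cancel_mono (0 : S ⟶ N i)]; simp)))
    (fun S _ => by
      by_contra! h
      apply Simple.not_isZero S
      refine (IsZero.iff_id_eq_zero S).2 (FGModuleCat.hom_ext (LinearMap.ext fun x => ?_))
      let g : FGModuleCat.of Λ Λ ⟶ S := ⟨ModuleCat.ofHom (LinearMap.toSpanSingleton Λ S x)⟩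
      have hg : g = 0 := by
        rw [← cancel_epi e.inv]
        refine biproduct.hom_ext' _ _ fun i => ?_
        rw [comp_zero, comp_zero]
        exact h i _
      have := congrArg (fun t : FGModuleCat.of Λ Λ ⟶ S => t.hom.hom (1 : Λ)) hg
      exact (one_smul Λ x).symm.trans this) S
  refine ⟨f ≫ biproduct.ι N i ≫ e.inv, fun h0 => hf ?_⟩
  rw [← cancel_mono (biproduct.ι N i ≫ e.inv), h0, zero_comp]

/-- Every finitely generated module over a basic self-injective algebra embeds into a
projective-injective module. -/
theorem exists_mono_isProjInj (k : Type*) [Field k] {Λ : Type u} [Ring Λ] [Algebra k Λ]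
    [Module.Finite k Λ]
    (hbasic : IsBasic (FGModuleCat.of Λ Λ))
    (hΛ : IsProjInj (FGModuleCat.of Λ Λ)) (M : FGModuleCat.{u} Λ) :
    ∃ (I : FGModuleCat.{u} Λ) (_ : IsProjInj I) (f : M ⟶ I), Mono f := by
  have : IsNoetherianRing Λ := isNoetherianRing_of_finite k
  have : IsArtinianRing Λ := IsArtinianRing.of_finite k Λ
  let A : Set (Submodule Λ M) :=
    {K | ∃ (I : FGModuleCat.{u} Λ) (_ : IsProjInj I) (f : M ⟶ I), K = LinearMap.ker f.hom.hom}
  have hA : A.Nonempty := ⟨_, _, hΛ, 0, rfl⟩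
  obtain ⟨K, ⟨I, hI, f, rfl⟩, hmin⟩ :=
    (wellFounded_lt (α := Submodule Λ M)).has_min A hA
  refine ⟨I, hI, f, ?_⟩
  by_contra hf
  have hker : ¬ IsZero (kernel f) := fun h0 =>
    hf (Abelian.mono_of_kernel_ι_eq_zero _ (h0.eq_of_src _ _))
  obtain ⟨S, hS, s, _⟩ := exists_simple_mono (kernel f) hker
  -- `f` has minimal kernel among maps into projective-injectives. A nonzero map to `Λ` from a
  -- simple submodule of the kernel extends to `M`; as an extra component it shrinks the kernel.
  obtain ⟨t, ht⟩ := exists_ne_zero_to_ring k hbasic hΛ S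
  have := hΛ.2
  let g : M ⟶ FGModuleCat.of Λ Λ := Injective.factorThru t (s ≫ kernel.ι f)
  have hg : (s ≫ kernel.ι f) ≫ g = t := Injective.comp_factorThru _ _
  refine hmin _ ⟨I ⊞ FGModuleCat.of Λ Λ, hI.biprod hΛ, biprod.lift f g, rfl⟩ ?_
  have apply_comp {X Y Z : FGModuleCat.{u} Λ} (a : X ⟶ Y) (b : Y ⟶ Z) (x : X) :
    (a ≫ b).hom.hom x = b.hom.hom (a.hom.hom x) := rfl
  refine lt_of_le_of_ne ?_ ?_
  · intro x hx
    rw [LinearMap.mem_ker] at hx ⊢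
    rw [← biprod.lift_fst f g, apply_comp, hx, map_zero]
  · intro heq
    apply ht
    refine FGModuleCat.hom_ext (LinearMap.ext fun x => ?_)
    rw [← hg, apply_comp]
    have hx : (s ≫ kernel.ι f).hom.hom x ∈ LinearMap.ker f.hom.hom := by
      rw [LinearMap.mem_ker, ← apply_comp, Category.assoc, kernel.condition, comp_zero]
      rfl
    rw [← heq, LinearMap.mem_ker] at hx
    rw [← biprod.lift_snd f g, apply_comp, hx, map_zero]
    rfl

end Cogenerator

/-! ### Linear structure on the category of morphisms. -/

section ArrowLinear

variable {k : Type*} [Field k] {C : Type*} [Category* C] [Preadditive C] [Linear k C]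

instance {X Y : Arrow C} : SMul k (X ⟶ Y) where
  smul c φ := Arrow.homMk (u := c • φ.left) (v := c • φ.right) (by simp)

instance : Linear k (Arrow C) where
  homModule X Y :=
    { one_smul φ := Arrow.hom_ext _ _ (one_smul k φ.left) (one_smul k φ.right)
      mul_smul c d φ := Arrow.hom_ext _ _ (mul_smul c d φ.left) (mul_smul c d φ.right)
      smul_zero c := Arrow.hom_ext _ _ (smul_zero c) (smul_zero c)
      smul_add c φ ψ :=
        Arrow.hom_ext _ _ (smul_add c φ.left ψ.left) (smul_add c φ.right ψ.right)
      add_smul c d φ := Arrow.hom_ext _ _ (add_smul c d φ.left) (add_smul c d φ.right)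
      zero_smul φ := Arrow.hom_ext _ _ (zero_smul k φ.left) (zero_smul k φ.right) }
  smul_comp _ _ _ c φ ψ := Arrow.hom_ext _ _ (Linear.smul_comp _ _ _ c φ.left ψ.left)
    (Linear.smul_comp _ _ _ c φ.right ψ.right)
  comp_smul _ _ _ φ c ψ := Arrow.hom_ext _ _ (Linear.comp_smul _ _ _ φ.left c ψ.left)
    (Linear.comp_smul _ _ _ φ.right c ψ.right)

instance (X Y : Arrow C) [Module.Finite k (X.left ⟶ Y.left)]
    [Module.Finite k (X.right ⟶ Y.right)] : Module.Finite k (X ⟶ Y) := by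
  let f : (X ⟶ Y) →ₗ[k] (X.left ⟶ Y.left) × (X.right ⟶ Y.right) :=
    { toFun := fun φ => (φ.left, φ.right)
      map_add' := fun _ _ => rfl
      map_smul' := fun _ _ => rfl }
  refine Module.Finite.of_injective f fun φ ψ h => ?_
  ext
  · exact congrArg Prod.fst h
  · exact congrArg Prod.snd h

end ArrowLinear

/-! ### Basic structure of `S(Λ)`. -/

section SubBasics

variable {Λ : Type u} [Ring Λ]

/-- The functor `S(Λ) ⥤ mod Λ` that takes the source of a monomorphism. -/
abbrev sourceFunctor (Λ : Type u) [Ring Λ] : Sub Λ ⥤ FGModuleCat.{u} Λ := η ⋙ Arrow.leftFunc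

/-- The functor `S(Λ) ⥤ mod Λ` that takes the target of a monomorphism. -/
abbrev targetFunctor (Λ : Type u) [Ring Λ] : Sub Λ ⥤ FGModuleCat.{u} Λ := η ⋙ Arrow.rightFunc

/-- A morphism in `S(Λ)` from its two components. -/
abbrev Sub.homMk {X Y : Sub Λ} (a : X.obj.left ⟶ Y.obj.left) (b : X.obj.right ⟶ Y.obj.right)
    (w : a ≫ Y.obj.hom = X.obj.hom ≫ b) : X ⟶ Y :=
  ObjectProperty.homMk (Arrow.homMk (u := a) (v := b) w)

theorem Sub.hom_ext {X Y : Sub Λ} {f g : X ⟶ Y} (hl : f.hom.left = g.hom.left)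
    (hr : f.hom.right = g.hom.right) : f = g := by
  ext1; ext1
  · exact hl
  · exact hr

instance (X : Sub Λ) : Mono X.obj.hom := X.property

theorem Sub.hom_ext_right {X Y : Sub Λ} {f g : X ⟶ Y} (hr : f.hom.right = g.hom.right) :
    f = g := by
  refine Sub.hom_ext ?_ hr
  rw [← cancel_mono Y.obj.hom, Arrow.w f.hom, Arrow.w g.hom, hr]

instance [IsNoetherianRing Λ] : IsIdempotentComplete (Sub Λ) where
  idempotents_split X e he := by
    obtain ⟨Y₁, i₁, p₁, h₁, h₁'⟩ := IsIdempotentComplete.idempotents_split X.obj.left e.hom.left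
      (congrArg (fun t => t.hom.left) he)
    obtain ⟨Y₀, i₀, p₀, h₀, h₀'⟩ := IsIdempotentComplete.idempotents_split X.obj.right e.hom.right
      (congrArg (fun t => t.hom.right) he)
    have w : e.hom.left ≫ X.obj.hom = X.obj.hom ≫ e.hom.right := Arrow.w e.hom
    have hi : i₁ ≫ e.hom.left = i₁ := by rw [← h₁', reassoc_of% h₁]
    have hp : e.hom.right ≫ p₀ = p₀ := by rw [← h₀', Category.assoc, h₀, Category.comp_id]
    -- The components are split separately; the induced map of images is mono because it becomes the
    -- mono `i₁ ≫ X.obj.hom` after `i₀`.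
    have hw : (i₁ ≫ X.obj.hom ≫ p₀) ≫ i₀ = i₁ ≫ X.obj.hom := by
      rw [Category.assoc, Category.assoc, h₀', ← w, reassoc_of% hi]
    have : Mono i₁ := mono_of_mono_fac h₁
    have : Mono (i₁ ≫ X.obj.hom ≫ p₀) := mono_of_mono_fac hw
    refine ⟨Sub.mk (i₁ ≫ X.obj.hom ≫ p₀), Sub.homMk i₁ i₀ hw.symm, Sub.homMk p₁ p₀ ?_, ?_, ?_⟩
    · change p₁ ≫ i₁ ≫ X.obj.hom ≫ p₀ = X.obj.hom ≫ p₀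
      rw [reassoc_of% h₁', reassoc_of% w, hp]
    · exact Sub.hom_ext h₁ h₀
    · exact Sub.hom_ext h₁' h₀'

/-- The functor `M ↦ (M = M)`. -/
def identityFunctor (Λ : Type u) [Ring Λ] : FGModuleCat.{u} Λ ⥤ Sub Λ where
  obj M := Sub.mk (𝟙 M)
  map f := Sub.homMk f f (by simp [Sub.mk])

/-- The functor `M ↦ (0 ⟶ M)`. -/
def zeroFunctor (Λ : Type u) [Ring Λ] : FGModuleCat.{u} Λ ⥤ Sub Λ where
  obj M := Sub.mk (0 : zeroModule ⟶ M)
  map f := Sub.homMk (𝟙 zeroModule) f (by simp [Sub.mk])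

instance : (identityFunctor Λ).Additive where
  map_add := Sub.hom_ext_right rfl

instance : (zeroFunctor Λ).Additive where
  map_add := Sub.hom_ext_right rfl

/-- The functor `M ↦ (M = M)` is fully faithful. -/
def identityFunctorFullyFaithful : (identityFunctor Λ).FullyFaithful where
  preimage f := f.hom.right
  map_preimage _ := Sub.hom_ext_right rfl
  preimage_map _ := rfl

/-- The functor `M ↦ (0 ⟶ M)` is fully faithful. -/
def zeroFunctorFullyFaithful : (zeroFunctor Λ).FullyFaithful where
  preimage f := f.hom.right
  map_preimage _ := Sub.hom_ext_right rfl
  preimage_map _ := rfl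

/-- A monomorphism that is an isomorphism is isomorphic to an identity. -/
def isoIdentity (X : Sub Λ) [IsIso X.obj.hom] : (identityFunctor Λ).obj X.obj.right ≅ X where
  hom := ObjectProperty.homMk (Arrow.homMk (u := (inv X.obj.hom : X.obj.right ⟶ X.obj.left))
    (v := 𝟙 X.obj.right) (by
      change inv X.obj.hom ≫ X.obj.hom = 𝟙 _ ≫ 𝟙 _
      simp))
  inv := ObjectProperty.homMk (Arrow.homMk (u := X.obj.hom) (v := 𝟙 X.obj.right) rfl)
  hom_inv_id := Sub.hom_ext_right (Category.comp_id _)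
  inv_hom_id := Sub.hom_ext_right (Category.comp_id _)

/-- A monomorphism with zero source is isomorphic to `0 ⟶ M`. -/
def isoZero (X : Sub Λ) (h : IsZero X.obj.left) : (zeroFunctor Λ).obj X.obj.right ≅ X where
  hom := Sub.homMk 0 (𝟙 _) ((isZero_zeroModule Λ).eq_of_src _ _)
  inv := Sub.homMk 0 (𝟙 _) (h.eq_of_src _ _)
  hom_inv_id := Sub.hom_ext_right (Category.comp_id _)
  inv_hom_id := Sub.hom_ext_right (Category.comp_id _)

variable (k : Type*) [Field k] [Algebra k Λ] [Module.Finite k Λ]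

open ModuleCat in
instance (X Y : Sub Λ) : Module.Finite k (X ⟶ Y) := by
  let f : (X ⟶ Y) →ₗ[k] (X.obj ⟶ Y.obj) :=
    { toFun := fun φ => φ.hom
      map_add' := fun _ _ => rfl
      map_smul' := fun _ _ => rfl }
  exact Module.Finite.of_injective f fun φ ψ h => ObjectProperty.hom_ext _ h

end SubBasics

/-! ### Counting isomorphism classes of indecomposables. -/

section Counting

variable {C D : Type*} [Category* C] [Category* D]

theorem Indecomposable.of_iso [HasZeroMorphisms C] [HasBinaryBiproducts C] {X Y : C} (e : X ≅ Y)
    (h : Indecomposable X) : Indecomposable Y :=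
  ⟨fun hY => h.1 (hY.of_iso e), fun A B f => h.2 A B (e ≪≫ f)⟩

theorem indecomposable_map_iff [Preadditive C] [Preadditive D] [HasBinaryBiproducts C]
    [HasBinaryBiproducts D] [IsIdempotentComplete C] [IsIdempotentComplete D] {F : C ⥤ D}
    [F.Additive] (hF : F.FullyFaithful) {X : C} :
    Indecomposable (F.obj X) ↔ Indecomposable X := by
  have hz : ∀ e : X ⟶ X, F.map e = 0 ↔ e = 0 := fun e =>
    ⟨fun h => hF.map_injective (by rw [h, F.map_zero]), fun h => by rw [h, F.map_zero]⟩
  have h1 : ∀ e : X ⟶ X, F.map e = 𝟙 _ ↔ e = 𝟙 X := fun e =>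
    ⟨fun h => hF.map_injective (by rw [h, F.map_id]), fun h => by rw [h, F.map_id]⟩
  rw [indecomposable_iff, indecomposable_iff, IsZero.iff_id_eq_zero, IsZero.iff_id_eq_zero,
    ← F.map_id, hz]
  refine and_congr_right fun _ => ⟨fun h e he => ?_, fun h e he => ?_⟩
  · have := h (F.map e) (by rw [← F.map_comp, he])
    rwa [hz, F.map_id, h1] at this
  · obtain ⟨e, rfl⟩ := hF.map_surjective e
    have := h e (hF.map_injective (by rw [F.map_comp, he]))
    rwa [hz, F.map_id, h1]

/-- `Φ` and `Ψ` are mere functions on objects because the minimal embeddings used for `U` are not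
chosen functorially. -/
theorem encard_indClasses_eq_two_mul [Preadditive C] [Preadditive D] [HasBinaryBiproducts C]
    [HasBinaryBiproducts D] (P : ObjectProperty D) (Φ Ψ : C → D)
    (hΦ : ∀ M, Indecomposable M → Indecomposable (Φ M) ∧ P (Φ M))
    (hΨ : ∀ M, Indecomposable M → Indecomposable (Ψ M) ∧ P (Ψ M))
    (hΦΦ : ∀ M N, Indecomposable M → Indecomposable N →
      (Nonempty (Φ M ≅ Φ N) ↔ Nonempty (M ≅ N)))
    (hΨΨ : ∀ M N, Indecomposable M → Indecomposable N →
      (Nonempty (Ψ M ≅ Ψ N) ↔ Nonempty (M ≅ N)))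
    (hΦΨ : ∀ M N, Indecomposable M → Indecomposable N → ¬ Nonempty (Φ M ≅ Ψ N))
    (hsurj : ∀ X, Indecomposable X → P X →
      ∃ M, Indecomposable M ∧ (Nonempty (X ≅ Φ M) ∨ Nonempty (X ≅ Ψ M))) :
    (indClasses P).encard = 2 * (indClasses (⊤ : ObjectProperty C)).encard := by
  let S := indClasses (⊤ : ObjectProperty C)
  have hout : ∀ M : C, Nonempty (M ≅ (Quotient.mk (isIsomorphicSetoid C) M).out) := fun M =>
    ((Quotient.mk_out (s := isIsomorphicSetoid C) M : IsIsomorphic _ _)).map Iso.symm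
  have hS : ∀ c ∈ S, Indecomposable c.out := by
    rintro _ ⟨M, hM, -, rfl⟩
    obtain ⟨e⟩ := hout M
    exact Indecomposable.of_iso e hM
  have hS' : ∀ M : C, Indecomposable M → Quotient.mk (isIsomorphicSetoid C) M ∈ S :=
    fun M hM => ⟨M, hM, trivial, rfl⟩
  have hext : ∀ c c' : _root_.Quotient (isIsomorphicSetoid C), Nonempty (c.out ≅ c'.out) →
      c = c' := fun c c' h => Quotient.out_equiv_out.1 h
  let f : _root_.Quotient (isIsomorphicSetoid C) → _root_.Quotient (isIsomorphicSetoid D) :=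
    fun c => Quotient.mk _ (Φ c.out)
  let g : _root_.Quotient (isIsomorphicSetoid C) → _root_.Quotient (isIsomorphicSetoid D) :=
    fun c => Quotient.mk _ (Ψ c.out)
  have hU : indClasses P = f '' S ∪ g '' S := by
    ext c
    constructor
    · rintro ⟨X, hX, hPX, rfl⟩
      obtain ⟨M, hM, ⟨⟨e⟩⟩ | ⟨⟨e⟩⟩⟩ := hsurj X hX hPX
      · obtain ⟨e'⟩ := (hΦΦ _ _ hM (hS _ (hS' M hM))).2 (hout M)
        exact Or.inl ⟨_, hS' M hM, Quotient.sound ⟨(e ≪≫ e').symm⟩⟩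
      · obtain ⟨e'⟩ := (hΨΨ _ _ hM (hS _ (hS' M hM))).2 (hout M)
        exact Or.inr ⟨_, hS' M hM, Quotient.sound ⟨(e ≪≫ e').symm⟩⟩
    · rintro (⟨c, hc, rfl⟩ | ⟨c, hc, rfl⟩)
      · exact ⟨_, (hΦ _ (hS c hc)).1, (hΦ _ (hS c hc)).2, rfl⟩
      · exact ⟨_, (hΨ _ (hS c hc)).1, (hΨ _ (hS c hc)).2, rfl⟩
  have hf : Set.InjOn f S := fun c hc c' hc' h =>
    hext c c' ((hΦΦ _ _ (hS c hc) (hS c' hc')).1 (Quotient.exact h))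
  have hg : Set.InjOn g S := fun c hc c' hc' h =>
    hext c c' ((hΨΨ _ _ (hS c hc) (hS c' hc')).1 (Quotient.exact h))
  have hd : Disjoint (f '' S) (g '' S) := by
    rw [Set.disjoint_left]
    rintro _ ⟨c, hc, rfl⟩ ⟨c', hc', h⟩
    exact hΦΨ _ _ (hS c hc) (hS c' hc') (Quotient.exact h.symm)
  rw [hU, Set.encard_union_eq hd, hf.encard_image, hg.encard_image, two_mul]

end Counting

/-! ### Indecomposable objects of `S(Λ)` with projective-injective target. -/

section SubIndecomposable

/-- Separates the single generator of `V` into its two summands, so that an indecomposable is a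
retract of one of them. -/
theorem mem_factorSubgroup_of_biprod {C : Type*} [Category* C] [Preadditive C]
    [HasBinaryBiproducts C] {A B X Y : C} {f : X ⟶ Y}
    (hf : f ∈ factorSubgroup (fun Z => Z = (A ⊞ B)) X Y) :
    f ∈ factorSubgroup (fun Z => Z = A ∨ Z = B) X Y := by
  refine factorSubgroup_induction (p := fun f => f ∈ factorSubgroup _ X Y) ?_ (zero_mem _)
    (fun f g => add_mem) hf
  rintro Z a b hZ
  subst hZ
  have : a ≫ b = (a ≫ biprod.fst) ≫ biprod.inl ≫ b + (a ≫ biprod.snd) ≫ biprod.inr ≫ b := by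
    have h : a ≫ b = a ≫ 𝟙 _ ≫ b := by simp
    rw [h, ← biprod.total]
    simp only [Preadditive.add_comp, Preadditive.comp_add, Category.assoc]
  rw [this]
  exact add_mem (comp_mem_factorSubgroup (P := fun Z => Z = A ∨ Z = B) (Or.inl rfl) _ _)
    (comp_mem_factorSubgroup (P := fun Z => Z = A ∨ Z = B) (Or.inr rfl) _ _)

variable {Λ : Type u} [Ring Λ]

theorem isIso_hom_of_retract {X Z : Sub Λ} (R : Retract X Z) [IsIso Z.obj.hom] :
    IsIso X.obj.hom := by
  have wi : R.i.hom.left ≫ Z.obj.hom = X.obj.hom ≫ R.i.hom.right := Arrow.w R.i.hom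
  have wr : R.r.hom.left ≫ X.obj.hom = Z.obj.hom ≫ R.r.hom.right := Arrow.w R.r.hom
  have hl : R.i.hom.left ≫ R.r.hom.left = 𝟙 _ := congrArg (fun t => t.hom.left) R.retract
  have hr : R.i.hom.right ≫ R.r.hom.right = 𝟙 _ := congrArg (fun t => t.hom.right) R.retract
  refine ⟨⟨R.i.hom.right ≫ inv Z.obj.hom ≫ R.r.hom.left, ?_, ?_⟩⟩
  · rw [← reassoc_of% wi, IsIso.hom_inv_id_assoc, hl]
  · rw [Category.assoc, Category.assoc, wr, IsIso.inv_hom_id_assoc, hr]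

theorem isIso_hom_identityFunctor (M : FGModuleCat.{u} Λ) :
    IsIso ((identityFunctor Λ).obj M).obj.hom := inferInstanceAs (IsIso (𝟙 M))

section Noetherian

variable [IsNoetherianRing Λ]

theorem indecomposable_identityFunctor_iff {M : FGModuleCat.{u} Λ} :
    Indecomposable ((identityFunctor Λ).obj M) ↔ Indecomposable M :=
  indecomposable_map_iff identityFunctorFullyFaithful

theorem indecomposable_zeroFunctor_iff {M : FGModuleCat.{u} Λ} :
    Indecomposable ((zeroFunctor Λ).obj M) ↔ Indecomposable M :=
  indecomposable_map_iff zeroFunctorFullyFaithful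

theorem isIso_of_mono_of_length_le [IsArtinianRing Λ] {M N : FGModuleCat.{u} Λ} (i : M ⟶ N)
    [Mono i] (h : Module.length Λ N ≤ Module.length Λ M) : IsIso i := by
  refine isIso_of_bijective i ⟨injective_of_mono i, ?_⟩
  rw [← LinearMap.range_eq_top]
  by_contra hr
  have h1 := Submodule.length_lt hr
  have h2 := (LinearEquiv.ofInjective i.hom.hom (injective_of_mono i)).length_eq
  exact absurd (h.trans_eq h2) (not_le_of_gt h1)

end Noetherian

theorem exists_retract_of_additiveClosure (k : Type*) [Field k] [Algebra k Λ]
    [Module.Finite k Λ] [IsNoetherianRing Λ] {P : ObjectProperty (Sub Λ)}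
    {X : Sub Λ} (hX : Indecomposable X) (h : 𝟙 X ∈ factorSubgroup P X X) :
    ∃ Z, P Z ∧ Nonempty (Retract X Z) :=
  exists_retract_of_id_mem_factorSubgroup hX.1 (isNilpotent_or_isUnit_of_indecomposable k hX) h

/-- A monomorphism from `M` to a projective-injective module of minimal length is
indecomposable if `M` is. -/
theorem exists_indecomposable_envelope [IsArtinianRing Λ] [IsNoetherianRing Λ]
    {M : FGModuleCat.{u} Λ}
    (hcog : ∃ (I : FGModuleCat.{u} Λ) (_ : IsProjInj I) (f : M ⟶ I), Mono f)
    (hM : Indecomposable M) :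
    ∃ X : Sub Λ, Indecomposable X ∧ IsProjInj X.obj.right ∧ Nonempty (X.obj.left ≅ M) := by
  let A : Set (Sub Λ) := {X | IsProjInj X.obj.right ∧ Nonempty (X.obj.left ≅ M)}
  have hA : A.Nonempty := by
    obtain ⟨I, hI, f, _⟩ := hcog
    exact ⟨Sub.mk f, hI, ⟨Iso.refl _⟩⟩
  obtain ⟨X, ⟨hX, ⟨e⟩⟩, hmin⟩ :=
    (InvImage.wf (fun X : Sub Λ => Module.length Λ X.obj.right)
      (wellFounded_lt (α := ℕ∞))).has_min A hA
  have hleft : Indecomposable X.obj.left := Indecomposable.of_iso e.symm hM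
  -- The image of such an idempotent is again an embedding of `M` into a projective-injective.
  -- Minimal length forces its target to be all of the target of `X`.
  have key : ∀ a : X ⟶ X, a ≫ a = a → a.hom.left = 𝟙 _ → a = 𝟙 X := by
    intro a ha hl
    obtain ⟨Y, i, p, hip, hpi⟩ := IsIdempotentComplete.idempotents_split X a ha
    let R : Retract Y X := ⟨i, p, hip⟩
    have hY : Y ∈ A := ⟨hX.of_retract (R.map (targetFunctor Λ)),
      ⟨⟨i.hom.left, p.hom.left, congrArg (fun t => t.hom.left) hip,
        (congrArg (fun t => t.hom.left) hpi).trans hl⟩ ≪≫ e⟩⟩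
    have hip' : i.hom.right ≫ p.hom.right = 𝟙 _ := congrArg (fun t => t.hom.right) hip
    have : Mono i.hom.right := mono_of_mono_fac hip'
    have : IsIso i.hom.right := isIso_of_mono_of_length_le _ (not_lt.1 (hmin Y hY))
    refine Sub.hom_ext_right ?_
    have h1 : p.hom.right = inv i.hom.right := IsIso.eq_inv_of_hom_inv_id hip'
    have h2 : p.hom.right ≫ i.hom.right = a.hom.right := congrArg (fun t => t.hom.right) hpi
    rw [← h2, h1, IsIso.inv_hom_id]
    rfl
  refine ⟨X, indecomposable_iff.2 ⟨fun h0 => hleft.1 ((sourceFunctor Λ).map_isZero h0),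
    fun a ha => ?_⟩, hX, ⟨e⟩⟩
  rcases (indecomposable_iff.1 hleft).2 a.hom.left (congrArg (fun t => t.hom.left) ha) with h | h
  · left
    have := key (𝟙 X - a) (by simp [ha]) (by
      have h' : (𝟙 X - a).hom.left = 𝟙 _ - a.hom.left := rfl
      rw [h', h, sub_zero])
    simpa using this
  · right
    exact key a ha h

/-- The morphism `(M₁ = M₁) ⟶ (M₁ ⟶ M₀)`. -/
def fromIdentity (X : Sub Λ) : (identityFunctor Λ).obj X.obj.left ⟶ X :=
  ObjectProperty.homMk (Arrow.homMk (u := 𝟙 X.obj.left) (v := X.obj.hom) rfl)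

theorem fromIdentity_ne_zero {X : Sub Λ} (h : ¬ IsZero X.obj.left) : fromIdentity X ≠ 0 :=
  fun h0 => h ((IsZero.iff_id_eq_zero _).2 (congrArg (fun t => t.hom.left) h0))

/-- Such an `a` fixes the nonzero morphism `fromIdentity X`, hence is not nilpotent. -/
theorem isIso_of_left_eq_id (k : Type*) [Field k] [Algebra k Λ]
    [Module.Finite k Λ] [IsNoetherianRing Λ] {X : Sub Λ} (hX : Indecomposable X)
    (h : ¬ IsZero X.obj.left) {a : X ⟶ X} (ha : a.hom.left = 𝟙 _) : IsIso a := by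
  refine isIso_of_comp_eq (isNilpotent_or_isUnit_of_indecomposable k hX)
    (fromIdentity_ne_zero h) (Sub.hom_ext_right ?_)
  change X.obj.hom ≫ a.hom.right = X.obj.hom
  have w : a.hom.left ≫ X.obj.hom = X.obj.hom ≫ a.hom.right := Arrow.w a.hom
  rw [← w, ha, Category.id_comp]

/-- A morphism between the sources extends if the target of the target is injective. -/
theorem exists_hom_left_eq {X Y : Sub Λ} [Injective Y.obj.right] (f : X.obj.left ⟶ Y.obj.left) :
    ∃ g : X ⟶ Y, g.hom.left = f :=
  ⟨ObjectProperty.homMk (Arrow.homMk (u := f)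
    (v := Injective.factorThru (f ≫ Y.obj.hom) X.obj.hom)
    (Injective.comp_factorThru _ _).symm), rfl⟩

/-- Uniqueness of the minimal embedding: `e` and its inverse extend to the injective targets, and
the composite is the identity on the source of `X`. -/
theorem nonempty_iso_of_left_iso (k : Type*) [Field k] [Algebra k Λ]
    [Module.Finite k Λ] [IsNoetherianRing Λ] {X Y : Sub Λ} (hX : Indecomposable X)
    (hY : Indecomposable Y) (hX' : IsProjInj X.obj.right) (hY' : IsProjInj Y.obj.right)
    (h : ¬ IsZero X.obj.left) (e : X.obj.left ≅ Y.obj.left) : Nonempty (X ≅ Y) := by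
  have := hX'.2
  have := hY'.2
  obtain ⟨f, hf⟩ := exists_hom_left_eq e.hom
  obtain ⟨g, hg⟩ := exists_hom_left_eq e.inv
  have : IsIso (f ≫ g) := isIso_of_left_eq_id k hX h (by
    change f.hom.left ≫ g.hom.left = _
    rw [hf, hg, e.hom_inv_id])
  exact nonempty_iso_of_retract ⟨f, g ≫ inv (f ≫ g), by rw [← Category.assoc]; simp⟩ hX.1
    (indecomposable_iff.1 hY).2

theorem indecomposable_left (k : Type*) [Field k] [Algebra k Λ]
    [Module.Finite k Λ] [IsNoetherianRing Λ] {X : Sub Λ} (hX : Indecomposable X)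
    (hX' : IsProjInj X.obj.right) (h : ¬ IsZero X.obj.left) : Indecomposable X.obj.left := by
  refine indecomposable_iff.2 ⟨h, fun e he => ?_⟩
  have := hX'.2
  obtain ⟨f, rfl⟩ := exists_hom_left_eq e
  -- The extension `f` of the idempotent need not be idempotent, but all its positive powers have
  -- the same left component. So `f` nilpotent makes that component zero, and `f` invertible makes
  -- it the identity.
  have hpow : ∀ n : ℕ, ((End.of f) ^ (n + 1)).asHom.hom.left = f.hom.left := by
    intro n
    induction n with
    | zero => rw [zero_add, pow_one]
    | succ n ih =>
      rw [pow_succ']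
      change ((End.of f) ^ (n + 1)).asHom.hom.left ≫ f.hom.left = _
      rw [ih, he]
  rcases isNilpotent_or_isUnit_of_indecomposable k hX (End.of f) with ⟨n, hn⟩ | hu
  · left
    rw [← hpow n, pow_succ, hn, zero_mul]
    rfl
  · right
    have : IsIso f := (isUnit_iff_isIso _).1 hu
    have : IsIso f.hom.left := inferInstanceAs (IsIso ((sourceFunctor Λ).map f))
    rw [← cancel_epi f.hom.left, he, Category.comp_id]

end SubIndecomposable

/-! ### The indecomposables of `U` and `V`. -/

section MembershipUV

variable {Λ : Type u} [Ring Λ] {E : FGModuleCat.{u} Λ}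

theorem U_identityFunctor (hgen : ∀ M : FGModuleCat.{u} Λ, add E M) (M : FGModuleCat.{u} Λ) :
    U E ((identityFunctor Λ).obj M) :=
  hgen M _ (isAdditiveSubcategory_obj (identityFunctor Λ)
    (isAdditiveSubcategory_additiveClosure _)) (by
      rintro _ rfl
      exact subset_additiveClosure _ (Or.inl rfl))

theorem U_of_isProjInj [IsNoetherianRing Λ] (X : Sub Λ) (h : IsProjInj X.obj.right) : U E X :=
  subset_additiveClosure _ (Or.inr ((isProjInj_iff _).1 h))

theorem V_generators (E : FGModuleCat.{u} Λ) :
    V E ((identityFunctor Λ).obj E) ∧ V E ((zeroFunctor Λ).obj E) := by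
  have h : V E (Sub.mk (𝟙 E) ⊞ Sub.mk (0 : zeroModule ⟶ E)) := subset_additiveClosure _ rfl
  have hV : IsAdditiveSubcategory (V E) := isAdditiveSubcategory_additiveClosure _
  let b := BinaryBiproduct.bicone (Sub.mk (𝟙 E)) (Sub.mk (0 : zeroModule ⟶ E))
  let b' : BinaryBicone (Sub.mk (0 : zeroModule ⟶ E)) (Sub.mk (𝟙 E)) :=
    { pt := b.pt, fst := b.snd, snd := b.fst, inl := b.inr, inr := b.inl }
  exact ⟨hV.summand _ _ b ⟨BinaryBiproduct.isBilimit _ _⟩ h,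
    hV.summand _ _ b' ⟨isBinaryBilimitOfTotal _ (by
      rw [add_comm]
      exact IsBilimit.binary_total (BinaryBiproduct.isBilimit _ _))⟩ h⟩

theorem V_identityFunctor (hgen : ∀ M : FGModuleCat.{u} Λ, add E M) (M : FGModuleCat.{u} Λ) :
    V E ((identityFunctor Λ).obj M) :=
  hgen M _ (isAdditiveSubcategory_obj (identityFunctor Λ)
    (isAdditiveSubcategory_additiveClosure _)) (by
      rintro _ rfl
      exact (V_generators _).1)

theorem V_zeroFunctor (hgen : ∀ M : FGModuleCat.{u} Λ, add E M) (M : FGModuleCat.{u} Λ) :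
    V E ((zeroFunctor Λ).obj M) :=
  hgen M _ (isAdditiveSubcategory_obj (zeroFunctor Λ)
    (isAdditiveSubcategory_additiveClosure _)) (by
      rintro _ rfl
      exact (V_generators _).2)

/-- An indecomposable of `U` is a retract of one generator, and both alternatives pass to retracts.
-/
theorem isIso_or_isProjInj_of_U (k : Type*) [Field k] [Algebra k Λ]
    [Module.Finite k Λ] [IsNoetherianRing Λ] {X : Sub Λ} (hX : Indecomposable X)
    (h : U E X) : IsIso X.obj.hom ∨ IsProjInj X.obj.right := by
  obtain ⟨Z, rfl | hZ, ⟨R⟩⟩ := exists_retract_of_additiveClosure k hX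
    (id_mem_factorSubgroup_of_additiveClosure h)
  · have : IsIso (Sub.mk (𝟙 E)).obj.hom := isIso_hom_identityFunctor E
    exact Or.inl (isIso_hom_of_retract R)
  · exact Or.inr (((isProjInj_iff _).2 hZ).of_retract (R.map (targetFunctor Λ)))

theorem isIso_or_isZero_of_V (k : Type*) [Field k] [Algebra k Λ]
    [Module.Finite k Λ] [IsNoetherianRing Λ] {X : Sub Λ} (hX : Indecomposable X)
    (h : V E X) : IsIso X.obj.hom ∨ IsZero X.obj.left := by
  obtain ⟨Z, rfl | rfl, ⟨R⟩⟩ := exists_retract_of_additiveClosure k hX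
    (mem_factorSubgroup_of_biprod (id_mem_factorSubgroup_of_additiveClosure h))
  · have : IsIso (Sub.mk (𝟙 E)).obj.hom := isIso_hom_identityFunctor E
    exact Or.inl (isIso_hom_of_retract R)
  · have R' : Retract X.obj.left zeroModule := R.map (sourceFunctor Λ)
    exact Or.inr ((IsZero.iff_id_eq_zero _).2 (by
      rw [← R'.retract, (isZero_zeroModule Λ).eq_of_src R'.r 0, comp_zero]))

theorem encard_indClasses_V (k : Type*) [Field k] [Algebra k Λ]
    [Module.Finite k Λ] (hgen : ∀ M : FGModuleCat.{u} Λ, add E M) :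
    (indClasses (V E)).encard = 2 * (indClasses (⊤ : ObjectProperty (FGModuleCat.{u} Λ))).encard := by
  have : IsNoetherianRing Λ := isNoetherianRing_of_finite k
  refine encard_indClasses_eq_two_mul _ (identityFunctor Λ).obj (zeroFunctor Λ).obj
    (fun M hM => ⟨indecomposable_identityFunctor_iff.2 hM, V_identityFunctor hgen M⟩)
    (fun M hM => ⟨indecomposable_zeroFunctor_iff.2 hM, V_zeroFunctor hgen M⟩)
    (fun M N _ _ => ⟨Nonempty.map identityFunctorFullyFaithful.preimageIso,
      Nonempty.map (identityFunctor Λ).mapIso⟩)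
    (fun M N _ _ => ⟨Nonempty.map zeroFunctorFullyFaithful.preimageIso,
      Nonempty.map (zeroFunctor Λ).mapIso⟩) ?_ ?_
  · rintro M N hM - ⟨e⟩
    exact hM.1 ((isZero_zeroModule Λ).of_iso ((sourceFunctor Λ).mapIso e))
  · intro X hX hV
    rcases isIso_or_isZero_of_V k hX hV with h | h
    · exact ⟨_, indecomposable_identityFunctor_iff.1 (Indecomposable.of_iso (isoIdentity X).symm hX),
        Or.inl ⟨(isoIdentity X).symm⟩⟩
    · exact ⟨_, indecomposable_zeroFunctor_iff.1 (Indecomposable.of_iso (isoZero X h).symm hX),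
        Or.inr ⟨(isoZero X h).symm⟩⟩

theorem encard_indClasses_U (k : Type*) [Field k] [Algebra k Λ]
    [Module.Finite k Λ] (hgen : ∀ M : FGModuleCat.{u} Λ, add E M)
    (hcog : ∀ M : FGModuleCat.{u} Λ,
      ∃ (I : FGModuleCat.{u} Λ) (_ : IsProjInj I) (f : M ⟶ I), Mono f) :
    (indClasses (U E)).encard = 2 * (indClasses (⊤ : ObjectProperty (FGModuleCat.{u} Λ))).encard := by
  have : IsNoetherianRing Λ := isNoetherianRing_of_finite k
  have : IsArtinianRing Λ := IsArtinianRing.of_finite k Λ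
  -- For projective-injective `M` the minimal embedding is `(M = M)`, which is already counted, so
  -- `(0 ⟶ M)` takes its place.
  have hex : ∀ M : FGModuleCat.{u} Λ, ∃ X : Sub Λ, Indecomposable M → Indecomposable X ∧
      IsProjInj X.obj.right ∧ (IsProjInj M ∧ Nonempty (X ≅ (zeroFunctor Λ).obj M) ∨
        ¬ IsProjInj M ∧ Nonempty (X.obj.left ≅ M)) := by
    intro M
    by_cases hM : Indecomposable M
    · by_cases hP : IsProjInj M
      · exact ⟨(zeroFunctor Λ).obj M, fun _ => ⟨indecomposable_zeroFunctor_iff.2 hM, hP,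
          Or.inl ⟨hP, ⟨Iso.refl _⟩⟩⟩⟩
      · obtain ⟨X, h1, h2, h3⟩ := exists_indecomposable_envelope (hcog M) hM
        exact ⟨X, fun _ => ⟨h1, h2, Or.inr ⟨hP, h3⟩⟩⟩
    -- A default value: only indecomposable `M` are counted.
    · exact ⟨(zeroFunctor Λ).obj M, fun h => absurd h hM⟩
  choose Ψ hΨ using hex
  have hleft : ∀ {M : FGModuleCat.{u} Λ} {X : Sub Λ}, (X ≅ (zeroFunctor Λ).obj M) →
      IsZero X.obj.left := fun e => (isZero_zeroModule Λ).of_iso ((sourceFunctor Λ).mapIso e)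
  refine encard_indClasses_eq_two_mul _ (identityFunctor Λ).obj Ψ
    (fun M hM => ⟨indecomposable_identityFunctor_iff.2 hM, U_identityFunctor hgen M⟩)
    (fun M hM => ⟨(hΨ M hM).1, U_of_isProjInj _ (hΨ M hM).2.1⟩)
    (fun M N _ _ => ⟨Nonempty.map identityFunctorFullyFaithful.preimageIso,
      Nonempty.map (identityFunctor Λ).mapIso⟩) ?_ ?_ ?_
  · intro M N hM hN
    obtain ⟨hi, hr, ⟨hP, ⟨e⟩⟩ | ⟨hP, ⟨e⟩⟩⟩ := hΨ M hM <;>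
    obtain ⟨hi', hr', ⟨hP', ⟨e'⟩⟩ | ⟨hP', ⟨e'⟩⟩⟩ := hΨ N hN
    · exact ⟨fun ⟨f⟩ => ⟨zeroFunctorFullyFaithful.preimageIso (e.symm ≪≫ f ≪≫ e')⟩,
        fun ⟨f⟩ => ⟨e ≪≫ (zeroFunctor Λ).mapIso f ≪≫ e'.symm⟩⟩
    · exact ⟨fun ⟨f⟩ => (hN.1 ((hleft e).of_iso (e'.symm ≪≫ (sourceFunctor Λ).mapIso f.symm))).elim,
        fun ⟨f⟩ => (hP' (hP.of_retract (Retract.ofIso f.symm))).elim⟩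
    · exact ⟨fun ⟨f⟩ => (hM.1 ((hleft e').of_iso (e.symm ≪≫ (sourceFunctor Λ).mapIso f))).elim,
        fun ⟨f⟩ => (hP (hP'.of_retract (Retract.ofIso f))).elim⟩
    · exact ⟨fun ⟨f⟩ => ⟨e.symm ≪≫ (sourceFunctor Λ).mapIso f ≪≫ e'⟩,
        fun ⟨f⟩ => nonempty_iso_of_left_iso k hi hi' hr hr' (fun h => hM.1 (h.of_iso e.symm))
          (e ≪≫ f ≪≫ e'.symm)⟩
  · rintro M N hM hN ⟨f⟩
    obtain ⟨hi, hr, ⟨hP, ⟨e⟩⟩ | ⟨hP, ⟨e⟩⟩⟩ := hΨ N hN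
    · exact hM.1 ((hleft e).of_iso ((sourceFunctor Λ).mapIso f))
    -- An object isomorphic to `(M = M)` has isomorphic source and target, so `N` would be
    -- projective-injective.
    · refine hP (hr.of_retract (Retract.ofIso ?_))
      exact e.symm ≪≫ (sourceFunctor Λ).mapIso f.symm ≪≫ (targetFunctor Λ).mapIso f
  · intro X hX hU
    rcases isIso_or_isProjInj_of_U k hX hU with h | h
    · exact ⟨_, indecomposable_identityFunctor_iff.1 (Indecomposable.of_iso (isoIdentity X).symm hX),
        Or.inl ⟨(isoIdentity X).symm⟩⟩
    by_cases h0 : IsZero X.obj.left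
    · have hX0 := indecomposable_zeroFunctor_iff.1 (Indecomposable.of_iso (isoZero X h0).symm hX)
      obtain ⟨-, -, ⟨-, ⟨e⟩⟩ | ⟨hP, -⟩⟩ := hΨ _ hX0
      · exact ⟨_, hX0, Or.inr ⟨(isoZero X h0).symm ≪≫ e.symm⟩⟩
      · exact (hP h).elim
    · have hM := indecomposable_left k hX h h0
      refine ⟨X.obj.left, hM, ?_⟩
      by_cases hP : IsProjInj X.obj.left
      -- The identity of the source also has projective-injective target here, so uniqueness
      -- identifies it with `X`.
      · exact Or.inl (nonempty_iso_of_left_iso k hX (indecomposable_identityFunctor_iff.2 hM) h hP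
          h0 (Iso.refl _))
      · obtain ⟨hi, hr, ⟨hP', -⟩ | ⟨-, ⟨e⟩⟩⟩ := hΨ _ hM
        · exact (hP hP').elim
        · exact Or.inr (nonempty_iso_of_left_iso k hX hi h hr h0 e.symm)

end MembershipUV

/-! ### Base change along a surjective ring homomorphism. -/

section Balanced

variable {A B : Type u} [Ring A] [Ring B] (φ : A →+* B)
variable (M : Type u) [AddCommGroup M] [Module A M]

/-- The canonical map `M ⟶ B ⊗_A M`. -/
def toBalancedTensor : M →ₛₗ[φ] BalancedTensor φ M where
  toFun m := (balancedRel φ M).mkQ ((1 : B) ⊗ₜ[ℤ] m)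
  map_add' x y := by rw [TensorProduct.tmul_add, map_add]
  map_smul' a m := by
    have h : (balancedRel φ M).mkQ ((1 : B) ⊗ₜ[ℤ] (a • m)) =
        (balancedRel φ M).mkQ ((1 * φ a) ⊗ₜ[ℤ] m) := by
      symm
      rw [← sub_eq_zero, ← map_sub, Submodule.mkQ_apply, Submodule.Quotient.mk_eq_zero]
      exact Submodule.subset_span ⟨1, a, m, rfl⟩
    rw [h, ← map_smul, TensorProduct.smul_tmul', smul_eq_mul, one_mul, mul_one]

variable {φ}

theorem toBalancedTensor_surjective (hφ : Function.Surjective φ) :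
    Function.Surjective (toBalancedTensor φ M) := by
  intro x
  obtain ⟨x, rfl⟩ := (balancedRel φ M).mkQ_surjective x
  induction x with
  | zero => exact ⟨0, by simp⟩
  | add x y hx hy =>
    obtain ⟨a, ha⟩ := hx
    obtain ⟨b, hb⟩ := hy
    exact ⟨a + b, by rw [map_add, map_add, ha, hb]⟩
  | tmul b m =>
    obtain ⟨a, rfl⟩ := hφ b
    refine ⟨a • m, ?_⟩
    rw [map_smulₛₗ]
    change φ a • (balancedRel φ M).mkQ ((1 : B) ⊗ₜ[ℤ] m) = _
    rw [← map_smul, TensorProduct.smul_tmul', smul_eq_mul, mul_one]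

-- For surjective `φ` the module `B ⊗_A M` is `M` modulo `(ker φ) M`. The inverse map sends `b ⊗ x`
-- to the class of `s b • x` for a set-theoretic section `s`; modulo `K` it does not depend on `s`.
variable {M} in
theorem mem_closure_of_toBalancedTensor_eq_zero (hφ : Function.Surjective φ) {m : M}
    (hm : toBalancedTensor φ M m = 0) :
    m ∈ AddSubgroup.closure {x : M | ∃ (a : A) (y : M), φ a = 0 ∧ x = a • y} := by
  set K := AddSubgroup.closure {x : M | ∃ (a : A) (y : M), φ a = 0 ∧ x = a • y}
  let s := Function.surjInv hφ
  have hs : ∀ b, φ (s b) = b := Function.surjInv_eq hφ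
  have key : ∀ (a a' : A) (x : M), φ a = φ a' →
      (QuotientAddGroup.mk (a • x) : M ⧸ K) = QuotientAddGroup.mk (a' • x) := by
    intro a a' x h
    rw [QuotientAddGroup.eq_iff_sub_mem, ← sub_smul]
    exact AddSubgroup.subset_closure ⟨_, _, by rw [map_sub, h, sub_self], rfl⟩
  let f : B →+ M →+ M ⧸ K := AddMonoidHom.mk'
    (fun b => AddMonoidHom.mk' (fun x => QuotientAddGroup.mk (s b • x)) fun x y => by
      rw [smul_add, QuotientAddGroup.mk_add]) fun b b' => by
        ext x
        change (QuotientAddGroup.mk (s (b + b') • x) : M ⧸ K) =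
          QuotientAddGroup.mk (s b • x) + QuotientAddGroup.mk (s b' • x)
        rw [← QuotientAddGroup.mk_add, ← add_smul]
        exact key _ _ _ (by rw [map_add, hs, hs, hs])
  have hf : ∀ b x, f b x = QuotientAddGroup.mk (s b • x) := fun _ _ => rfl
  let l : B ⊗[ℤ] M →+ M ⧸ K := TensorProduct.liftAddHom f fun z b x => by
    rw [map_zsmul, map_zsmul, AddMonoidHom.zsmul_apply]
  have hl : ∀ b x, l (b ⊗ₜ x) = QuotientAddGroup.mk (s b • x) := fun _ _ => rfl
  -- `l` is only additive, so the multiplier `c` is carried along to pass to the `B`-span of the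
  -- relations.
  have hrel : ∀ x ∈ balancedRel φ M, ∀ c : B, l (c • x) = 0 := by
    intro x hx
    refine Submodule.span_induction (p := fun x _ => ∀ c : B, l (c • x) = 0) ?_ ?_ ?_ ?_ hx
    · rintro _ ⟨b, a, y, rfl⟩ c
      rw [smul_sub, TensorProduct.smul_tmul', TensorProduct.smul_tmul', map_sub, hl, hl,
        sub_eq_zero, smul_smul]
      exact key _ _ _ (by simp only [map_mul, hs, smul_eq_mul, mul_assoc])
    · intro c
      rw [smul_zero, map_zero]
    · intro x y _ _ hx hy c
      rw [smul_add, map_add, hx, hy, add_zero]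
    · intro d x _ hx c
      rw [smul_smul, hx]
  have h1 := hrel _ ((Submodule.Quotient.mk_eq_zero _).1 hm) 1
  rw [one_smul, hl, key _ 1 m (by rw [hs, map_one]), one_smul] at h1
  exact (QuotientAddGroup.eq_zero_iff m).1 h1

end Balanced

/-! ### The values of the functors as quotients of `Hom(E, M₀)`. -/

section ClassMap

variable {Λ : Type u} [Ring Λ] {E : FGModuleCat.{u} Λ} (r : Retract (FGModuleCat.of Λ Λ) E)

/-- The projection of the Auslander algebra onto the stable Auslander algebra. -/
abbrev stableProj : Aus E →+* StableAus r :=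
  Ideal.Quotient.mk (TwoSidedIdeal.span {idem r}).asIdeal

theorem stableProj_surjective : Function.Surjective (stableProj r) :=
  Ideal.Quotient.mk_surjective

theorem Aus.smul_def {M : FGModuleCat.{u} Λ} (γ : Aus E) (h : E ⟶ M) : γ • h = γ.unop.asHom ≫ h :=
  rfl

/-- The endomorphisms of `E` that are sums of maps through `Λ` form a two-sided ideal containing
`e`, so they contain `ΓeΓ`. -/
theorem unop_mem_projSubgroup {γ : Aus E} (h : stableProj r γ = 0) :
    γ.unop.asHom ∈ projSubgroup E E := by
  let J : TwoSidedIdeal (Aus E) := TwoSidedIdeal.mk' {γ | γ.unop.asHom ∈ projSubgroup E E}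
    (projSubgroup E E).zero_mem (fun hx hy => (projSubgroup E E).add_mem hx hy) (fun hx => (projSubgroup E E).neg_mem hx)
    (fun {x y} hy => comp_left_mem_factorSubgroup x.unop.asHom hy)
    (fun {x y} hx => comp_right_mem_factorSubgroup y.unop.asHom hx)
  have hJ' : ∀ γ : Aus E, γ ∈ J ↔ γ.unop.asHom ∈ projSubgroup E E :=
    TwoSidedIdeal.mem_mk' _ _ _ _ _ _
  have hJ : TwoSidedIdeal.span {idem r} ≤ J := by
    rw [TwoSidedIdeal.span_le]
    rintro _ rfl
    exact (hJ' _).2 (comp_mem_projSubgroup r.r r.i)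
  have h1 : γ ∈ (TwoSidedIdeal.span {idem r}).asIdeal := Ideal.Quotient.eq_zero_iff_mem.1 h
  exact (hJ' _).1 (hJ (TwoSidedIdeal.mem_asIdeal.1 h1))

/-- Homomorphisms from `Hom(E, M)` to modules over the stable Auslander algebra vanish on morphisms
that factor through projectives. -/
theorem map_projSubgroup_eq_zero {M : FGModuleCat.{u} Λ} {N : Type*} [AddCommGroup N]
    [Module (StableAus r) N] (ψ : (E ⟶ M) →ₛₗ[stableProj r] N) {p : E ⟶ M}
    (hp : p ∈ projSubgroup E M) : ψ p = 0 := by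
  refine projSubgroup_induction (p := fun p => ψ p = 0) ?_ (map_zero _)
    (fun f g hf hg => by rw [map_add, hf, hg, add_zero]) hp
  intro a b
  -- As `Λ` is a summand of `E`, a map through `Λ` can be rewritten to pass through `e`, which
  -- becomes zero in `Γ/ΓeΓ`.
  have h : a ≫ b = (MulOpposite.op (End.of (a ≫ r.i)) : Aus E) • (idem r • (r.r ≫ b)) := by
    rw [Aus.smul_def, Aus.smul_def]
    change a ≫ b = (a ≫ r.i) ≫ (r.r ≫ r.i) ≫ r.r ≫ b
    simp
  have h0 : stableProj r (idem r) = 0 := Ideal.Quotient.eq_zero_iff_mem.2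
    (TwoSidedIdeal.mem_asIdeal.2 (TwoSidedIdeal.subset_span rfl))
  rw [h, map_smulₛₗ, map_smulₛₗ, h0, zero_smul, smul_zero]

/-- The canonical map from `Hom(E, M₀)` to the value of `(Γ / ΓeΓ) ⊗ α(-)` at `M₁ ⟶ M₀`. -/
def cls (f : Arrow (FGModuleCat.{u} Λ)) :
    (E ⟶ f.right) →ₛₗ[stableProj r] ((α E ⋙ q r).obj f : ModuleCat.{u} (StableAus r)) :=
  (toBalancedTensor (stableProj r) ((α E).obj f)).comp
    (cokernel.π ((preadditiveCoyonedaObj E).map f.hom)).hom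

variable {r}
variable {f f' : Arrow (FGModuleCat.{u} Λ)}

theorem cls_surjective : Function.Surjective (cls r f) :=
  (toBalancedTensor_surjective _ (stableProj_surjective r)).comp
    ((ModuleCat.epi_iff_surjective _).1 inferInstance)

theorem cls_naturality (φ : f ⟶ f') (h : E ⟶ f.right) :
    ((α E ⋙ q r).map φ).hom (cls r f h) = cls r f' (h ≫ φ.right) := by
  have h1 : ((α E).map φ).hom ((cokernel.π ((preadditiveCoyonedaObj E).map f.hom)).hom h) =
      (cokernel.π ((preadditiveCoyonedaObj E).map f'.hom)).hom (h ≫ φ.right) := by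
    have h2 : cokernel.π ((preadditiveCoyonedaObj E).map f.hom) ≫ (α E).map φ =
        (preadditiveCoyonedaObj E).map φ.right ≫
          cokernel.π ((preadditiveCoyonedaObj E).map f'.hom) := cokernel.π_desc _ _ _
    exact LinearMap.congr_fun (congrArg ModuleCat.Hom.hom h2) h
  exact congrArg (toBalancedTensor (stableProj r) ((α E).obj f')) h1

/-- The cokernel kills the maps through `f`; base change kills the action of `ΓeΓ`, which amounts to
the maps through projectives. -/
theorem cls_eq_zero_iff {h : E ⟶ f.right} : cls r f h = 0 ↔
    ∃ (u : E ⟶ f.left) (p : E ⟶ f.right), p ∈ projSubgroup E f.right ∧ h = u ≫ f.hom + p := by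
  constructor
  · intro hh
    set π := cokernel.π ((preadditiveCoyonedaObj E).map f.hom) with hπ
    have hsurj : Function.Surjective π.hom := (ModuleCat.epi_iff_surjective _).1 inferInstance
    have h1 := mem_closure_of_toBalancedTensor_eq_zero (stableProj_surjective r) hh
    have key : ∀ z ∈ AddSubgroup.closure {x : (α E).obj f | ∃ (a : Aus E) (y : (α E).obj f),
        stableProj r a = 0 ∧ x = a • y}, ∃ p ∈ projSubgroup E f.right, z = π.hom p := by
      intro z hz
      refine AddSubgroup.closure_induction (p := fun z _ => ∃ p ∈ projSubgroup E f.right,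
        z = π.hom p) ?_ ?_ ?_ ?_ hz
      · rintro _ ⟨a, y, ha, rfl⟩
        obtain ⟨y, rfl⟩ := hsurj y
        exact ⟨a.unop.asHom ≫ y, comp_right_mem_factorSubgroup _ (unop_mem_projSubgroup r ha),
          (map_smul π.hom a y).symm⟩
      · exact ⟨0, zero_mem _, (map_zero _).symm⟩
      · rintro _ _ - - ⟨p, hp, rfl⟩ ⟨p', hp', rfl⟩
        exact ⟨p + p', add_mem hp hp', (map_add _ _ _).symm⟩
      · rintro _ - ⟨p, hp, rfl⟩
        exact ⟨-p, neg_mem hp, (map_neg _ _).symm⟩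
    obtain ⟨p, hp, hz⟩ := key _ h1
    have h2 : π.hom (h - p) = 0 := (map_sub π.hom h p).trans (sub_eq_zero.2 hz)
    -- Comparison with the concrete quotient shows that the kernel of `π` is the range of `Hom(E,
    -- f)`.
    let ρ := (LinearMap.range ((preadditiveCoyonedaObj E).map f.hom).hom).mkQ
    have h3 : (preadditiveCoyonedaObj E).map f.hom ≫ ModuleCat.ofHom ρ = 0 :=
      ModuleCat.hom_ext (LinearMap.ext fun x => (Submodule.Quotient.mk_eq_zero _).2 ⟨x, rfl⟩)
    have h4 : ρ (h - p) = 0 := by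
      have h5 := LinearMap.congr_fun (congrArg ModuleCat.Hom.hom (cokernel.π_desc _ _ h3)) (h - p)
      refine h5.symm.trans ?_
      change (cokernel.desc _ _ h3).hom (π.hom (h - p)) = 0
      rw [h2, map_zero]
    obtain ⟨u, hu⟩ := (Submodule.Quotient.mk_eq_zero _).1 h4
    exact ⟨u, p, hp, sub_eq_iff_eq_add.1 hu.symm⟩
  · rintro ⟨u, p, hp, rfl⟩
    rw [map_add, map_projSubgroup_eq_zero r _ hp, add_zero]
    have h1 := LinearMap.congr_fun (congrArg ModuleCat.Hom.hom
      (cokernel.condition ((preadditiveCoyonedaObj E).map f.hom))) u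
    exact (congrArg (toBalancedTensor (stableProj r) ((α E).obj f)) h1).trans (map_zero _)

theorem hom_ext_cls {N : ModuleCat.{u} (StableAus r)} {φ ψ : (α E ⋙ q r).obj f ⟶ N}
    (h : ∀ x, φ.hom (cls r f x) = ψ.hom (cls r f x)) : φ = ψ :=
  ModuleCat.hom_ext (LinearMap.ext fun y => by
    obtain ⟨x, rfl⟩ := cls_surjective y
    exact h x)

instance : (α E ⋙ q r).Additive where
  map_add {f f' φ ψ} := hom_ext_cls fun x => by
    rw [cls_naturality]
    change cls r f' (x ≫ (φ.right + ψ.right)) = ((α E ⋙ q r).map φ).hom (cls r f x) +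
      ((α E ⋙ q r).map ψ).hom (cls r f x)
    rw [cls_naturality, cls_naturality, Preadditive.comp_add, map_add]

theorem isZero_of_cls_eq_zero (h : ∀ x, cls r f x = 0) : IsZero ((α E ⋙ q r).obj f) :=
  (IsZero.iff_id_eq_zero _).2 (hom_ext_cls fun x => by rw [h]; simp)

/-- `ψ` and `cls` are surjections from the same module with the same kernel. Density is proved
through this. -/
theorem nonempty_iso_of_semilinear {N : ModuleCat.{u} (StableAus r)}
    (ψ : (E ⟶ f.right) →ₛₗ[stableProj r] N) (hψ : Function.Surjective ψ)
    (h : ∀ x, ψ x = 0 ↔ cls r f x = 0) : Nonempty ((α E ⋙ q r).obj f ≅ N) := by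
  have h' : ∀ x y, ψ x = ψ y ↔ cls r f x = cls r f y := fun x y => by
    rw [← sub_eq_zero, ← map_sub, h, map_sub, sub_eq_zero]
  let s := Function.surjInv (cls_surjective (r := r) (f := f))
  have hs : ∀ y, cls r f (s y) = y := Function.surjInv_eq _
  let l : ((α E ⋙ q r).obj f : ModuleCat.{u} (StableAus r)) →ₗ[StableAus r] N :=
    { toFun := fun y => ψ (s y)
      map_add' := fun y y' => by rw [← map_add, h', map_add, hs, hs, hs]
      map_smul' := fun c y => by
        obtain ⟨c, rfl⟩ := stableProj_surjective r c
        rw [RingHom.id_apply, ← map_smulₛₗ, h', map_smulₛₗ, hs, hs] }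
  have hl : Function.Bijective l := by
    constructor
    · intro y y' hyy
      rw [← hs y, ← hs y']
      exact (h' _ _).1 hyy
    · intro n
      obtain ⟨x, rfl⟩ := hψ n
      exact ⟨cls r f x, (h' _ _).2 (hs _)⟩
  exact ⟨(LinearEquiv.ofBijective l hl).toModuleIso⟩

/-- The identity of `f.right` is a sum of composites `a ≫ b` through `E`. If `u` represents the
image under `φ` of the class of `b`, then `a ≫ u` is the contribution to `g`. -/
theorem exists_hom_of_hom_obj (hgen : ∀ M : FGModuleCat.{u} Λ, add E M)
    (φ : (α E ⋙ q r).obj f ⟶ (α E ⋙ q r).obj f') :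
    ∃ g : f.right ⟶ f'.right, ∀ h, φ.hom (cls r f h) = cls r f' (h ≫ g) := by
  have key : ∀ k ∈ factorSubgroup (fun Z => Z = E) f.right f.right, ∃ g : f.right ⟶ f'.right,
      ∀ h : E ⟶ f.right, φ.hom (cls r f (h ≫ k)) = cls r f' (h ≫ g) := by
    intro k hk
    refine factorSubgroup_induction (p := fun k => ∃ g : f.right ⟶ f'.right,
      ∀ h : E ⟶ f.right, φ.hom (cls r f (h ≫ k)) = cls r f' (h ≫ g)) ?_ ?_ ?_ hk
    · rintro Z a b hZ
      subst hZ
      obtain ⟨u, hu⟩ := cls_surjective (φ.hom (cls r f b))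
      refine ⟨a ≫ u, fun h => ?_⟩
      have e : ∀ {M : FGModuleCat.{u} Λ} (c : Z ⟶ M),
          h ≫ a ≫ c = (MulOpposite.op (End.of (h ≫ a)) : Aus Z) • c := fun c =>
        (Category.assoc _ _ _).symm
      rw [e, e, map_smulₛₗ (cls r f), map_smulₛₗ (cls r f'), hu, map_smul]
    · exact ⟨0, fun h => by simp⟩
    · rintro k k' ⟨g, hg⟩ ⟨g', hg'⟩
      exact ⟨g + g', fun h => by simp only [Preadditive.comp_add, map_add, hg, hg']⟩
  obtain ⟨g, hg⟩ := key _ (id_mem_factorSubgroup_of_additiveClosure (hgen _))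
  exact ⟨g, fun h => by rw [← hg, Category.comp_id]⟩

/-- With the identity of `X` a sum of composites `a ≫ b` through `E`, the decompositions of the maps
`b ≫ g` are composed with `a` and added. -/
theorem exists_eq_add_of_cls_eq_zero (hgen : ∀ M : FGModuleCat.{u} Λ, add E M)
    {X : FGModuleCat.{u} Λ} (g : X ⟶ f.right) (hg : ∀ h : E ⟶ X, cls r f (h ≫ g) = 0) :
    ∃ (t : X ⟶ f.left) (p : X ⟶ f.right), p ∈ projSubgroup X f.right ∧ g = t ≫ f.hom + p := by
  have key : ∀ k ∈ factorSubgroup (fun Z => Z = E) X X, ∃ (t : X ⟶ f.left) (p : X ⟶ f.right),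
      p ∈ projSubgroup X f.right ∧ k ≫ g = t ≫ f.hom + p := by
    intro k hk
    refine factorSubgroup_induction (p := fun k => ∃ (t : X ⟶ f.left) (p : X ⟶ f.right),
      p ∈ projSubgroup X f.right ∧ k ≫ g = t ≫ f.hom + p) ?_ ?_ ?_ hk
    · rintro Z a b hZ
      subst hZ
      obtain ⟨u, p, hp, e⟩ := cls_eq_zero_iff.1 (hg b)
      exact ⟨a ≫ u, a ≫ p, comp_left_mem_factorSubgroup a hp, by simp [e]⟩
    · exact ⟨0, 0, zero_mem _, by simp⟩
    · rintro k k' ⟨t, p, hp, e⟩ ⟨t', p', hp', e'⟩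
      exact ⟨t + t', p + p', add_mem hp hp', by
        rw [Preadditive.add_comp, e, e', Preadditive.add_comp]; abel⟩
  simpa using key _ (id_mem_factorSubgroup_of_additiveClosure (hgen X))

theorem isNoetherian_hom (k : Type*) [Field k] [Algebra k Λ] [Module.Finite k Λ]
    (M : FGModuleCat.{u} Λ) : IsNoetherian (Aus E) (E ⟶ M) := by
  have : IsScalarTower k (Aus E) (E ⟶ M) := ⟨fun c γ g =>
    Linear.smul_comp _ _ _ c γ.unop.asHom g⟩
  exact isNoetherian_of_tower k inferInstance

/-- Modules over the stable Auslander algebra have presentations by `Hom(E, -)`. -/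
theorem exists_presentation (k : Type*) [Field k] [Algebra k Λ] [Module.Finite k Λ]
    (N : FGModuleCat.{u} (StableAus r)) : ∃ (M₁ M₀ : FGModuleCat.{u} Λ) (g : M₁ ⟶ M₀)
      (ψ : (E ⟶ M₀) →ₛₗ[stableProj r] N), Function.Surjective ψ ∧
        ∀ h, ψ h = 0 ↔ ∃ u, h = u ≫ g := by
  obtain ⟨n, s, hs⟩ := Module.Finite.exists_fin (R := StableAus r) (M := N)
  let M₀ : FGModuleCat.{u} Λ := ⨁ fun _ : Fin n => E
  let ψ : (E ⟶ M₀) →ₛₗ[stableProj r] N :=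
    { toFun := fun h => ∑ j, stableProj r
        (MulOpposite.op (End.of (h ≫ biproduct.π (fun _ : Fin n => E) j))) • s j
      map_add' := fun h h' => by
        rw [← Finset.sum_add_distrib]
        refine Finset.sum_congr rfl fun j _ => ?_
        rw [← add_smul, ← RingHom.map_add, Preadditive.add_comp]
        rfl
      map_smul' := fun γ h => by
        rw [Finset.smul_sum]
        refine Finset.sum_congr rfl fun j _ => ?_
        rw [smul_smul, ← RingHom.map_mul, Aus.smul_def, Category.assoc]
        rfl }
  have hψ_apply : ∀ h, ψ h = ∑ j, stableProj r
      (MulOpposite.op (End.of (h ≫ biproduct.π (fun _ : Fin n => E) j))) • s j := fun _ => rfl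
  have hψ : Function.Surjective ψ := by
    intro x
    obtain ⟨c, rfl⟩ := (Submodule.mem_span_range_iff_exists_fun (StableAus r)).1
      (hs.ge (Submodule.mem_top (x := x)))
    choose γ hγ using fun j => stableProj_surjective r (c j)
    refine ⟨biproduct.lift fun j => (γ j).unop.asHom, ?_⟩
    rw [hψ_apply]
    refine Finset.sum_congr rfl fun j _ => ?_
    rw [biproduct.lift_π, ← hγ j]
    rfl
  -- `Hom(E, M₀)` is the free `Γ`-module on the chosen generators of `N`. Its submodule `ker ψ` is
  -- finitely generated, and the generators are the components of `g`.
  have := isNoetherian_hom (E := E) k M₀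
  obtain ⟨m, t, ht⟩ := Submodule.fg_iff_exists_fin_generating_family.1
    (IsNoetherian.noetherian (LinearMap.ker ψ))
  refine ⟨⨁ fun _ : Fin m => E, M₀, biproduct.desc t, ψ, hψ, fun h => ?_⟩
  rw [← LinearMap.mem_ker, ← ht, Submodule.mem_span_range_iff_exists_fun]
  constructor
  · rintro ⟨c, rfl⟩
    refine ⟨biproduct.lift fun j => (c j).unop.asHom, ?_⟩
    rw [biproduct.lift_desc]
    rfl
  · rintro ⟨u, rfl⟩
    refine ⟨fun j => MulOpposite.op (End.of (u ≫ biproduct.π (fun _ : Fin m => E) j)), ?_⟩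
    have : u = biproduct.lift fun j => u ≫ biproduct.π (fun _ : Fin m => E) j :=
      biproduct.hom_ext _ _ fun j => by rw [biproduct.lift_π]
    conv_rhs => rw [this, biproduct.lift_desc]
    rfl

end ClassMap

/-! ### Kernels, fullness and density of `F` and `G`. -/

section Functors

variable {Λ : Type u} [Ring Λ] {E : FGModuleCat.{u} Λ} {r : Retract (FGModuleCat.of Λ Λ) E}

theorem exists_epi_projective (M : FGModuleCat.{u} Λ) :
    ∃ (P : FGModuleCat.{u} Λ) (_ : Module.Projective Λ P) (f : P ⟶ M), Epi f := by
  obtain ⟨n, f, hf⟩ := Module.Finite.exists_fin' Λ M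
  refine ⟨FGModuleCat.of Λ (ULift.{u} (Fin n) → Λ),
    inferInstanceAs (Module.Projective Λ (ULift.{u} (Fin n) → Λ)),
    ⟨ModuleCat.ofHom (f ∘ₗ (LinearEquiv.funCongrLeft Λ Λ Equiv.ulift.{u}.symm).toLinearMap)⟩,
    epi_of_surjective _ (hf.comp (LinearEquiv.surjective _))⟩

theorem mem_projSubgroup_of_factor {X Y P : FGModuleCat.{u} Λ} [Module.Projective Λ P] (a : X ⟶ P)
    (b : P ⟶ Y) : a ≫ b ∈ projSubgroup X Y := by
  simpa using comp_left_mem_factorSubgroup a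
    (comp_right_mem_factorSubgroup b (id_mem_projSubgroup P))

/-- The homomorphism between the cokernels given by a morphism in `S(Λ)`. -/
def cokernelMap {X Y : Sub Λ} (φ : X ⟶ Y) : cokernel X.obj.hom ⟶ cokernel Y.obj.hom :=
  (ε.map φ).right

theorem π_cokernelMap {X Y : Sub Λ} (φ : X ⟶ Y) :
    cokernel.π X.obj.hom ≫ cokernelMap φ = φ.hom.right ≫ cokernel.π Y.obj.hom :=
  cokernel.π_desc _ _ _

theorem cokernelMap_eq {X Y : Sub Λ} (φ : X ⟶ Y) {g : cokernel X.obj.hom ⟶ cokernel Y.obj.hom}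
    (h : cokernel.π X.obj.hom ≫ g = φ.hom.right ≫ cokernel.π Y.obj.hom) : cokernelMap φ = g := by
  rw [← cancel_epi (cokernel.π X.obj.hom), π_cokernelMap, h]

instance : (ε : Sub Λ ⥤ _).Additive where
  map_add {X Y φ ψ} := Arrow.hom_ext _ _ rfl <| cokernelMap_eq (φ + ψ)
    (g := cokernelMap φ + cokernelMap ψ) (by
      rw [Preadditive.comp_add, π_cokernelMap, π_cokernelMap]
      exact (Preadditive.add_comp _ _ _ _ _ _).symm)

section F

variable (r) (k : Type*) [Field k] [Algebra k Λ] [Module.Finite k Λ]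

instance : (F r k).Additive where
  map_add {_ _ φ ψ} := ObjectProperty.hom_ext _ ((η ⋙ α E ⋙ q r).map_add (f := φ) (g := ψ))

instance : (G r k).Additive where
  map_add {_ _ φ ψ} := ObjectProperty.hom_ext _ ((ε ⋙ α E ⋙ q r).map_add (f := φ) (g := ψ))

theorem cls_eq_zero_of_F_map_eq_zero {X Y : Sub Λ} {φ : X ⟶ Y} (h : (F r k).map φ = 0)
    (x : E ⟶ X.obj.right) : cls r Y.obj (x ≫ φ.hom.right) = 0 := by
  have h' : (α E ⋙ q r).map (η.map φ) = 0 := congrArg (fun t => t.hom) h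
  refine (cls_naturality (η.map φ) x).symm.trans ?_
  rw [h']
  rfl

theorem cls_eq_zero_of_G_map_eq_zero {X Y : Sub Λ} {φ : X ⟶ Y} (h : (G r k).map φ = 0)
    (x : E ⟶ cokernel X.obj.hom) : cls r (ε.obj Y) (x ≫ cokernelMap φ) = 0 := by
  have h' : (α E ⋙ q r).map (ε.map φ) = 0 := congrArg (fun t => t.hom) h
  refine (cls_naturality (ε.map φ) x).symm.trans ?_
  rw [h']
  rfl

theorem isZero_F_obj {X : Sub Λ} (h : ∀ x, cls r X.obj x = 0) : IsZero ((F r k).obj X) :=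
  (IsZero.iff_id_eq_zero _).2 (ObjectProperty.hom_ext _
    ((IsZero.iff_id_eq_zero _).1 (isZero_of_cls_eq_zero h)))

theorem isZero_G_obj {X : Sub Λ} (h : ∀ x, cls r (ε.obj X) x = 0) : IsZero ((G r k).obj X) :=
  (IsZero.iff_id_eq_zero _).2 (ObjectProperty.hom_ext _
    ((IsZero.iff_id_eq_zero _).1 (isZero_of_cls_eq_zero h)))

theorem isZero_F_obj_of_U {X : Sub Λ} (hX : U E X) : IsZero ((F r k).obj X) := by
  refine hX _ (isAdditiveSubcategory_isZero_obj (F r k)) ?_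
  rintro X (rfl | ⟨hP, -⟩)
  · exact isZero_F_obj r k fun x => cls_eq_zero_iff.2
      ⟨x, 0, zero_mem _, ((add_zero _).trans (Category.comp_id x)).symm⟩
  · refine isZero_F_obj r k fun x => cls_eq_zero_iff.2 ⟨0, x, ?_, by rw [zero_comp, zero_add]⟩
    have : Module.Projective Λ X.obj.right := hP
    simpa using mem_projSubgroup_of_factor x (𝟙 X.obj.right)

theorem isZero_G_obj_of_V {X : Sub Λ} (hX : V E X) : IsZero ((G r k).obj X) := by
  have hG := isAdditiveSubcategory_isZero_obj (G r k)
  refine hX _ hG ?_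
  rintro _ rfl
  refine hG.directSum _ _ (BinaryBiproduct.bicone _ _) ⟨BinaryBiproduct.isBilimit _ _⟩ ?_ ?_
  · refine isZero_G_obj r k fun x => ?_
    have h0 : IsZero (ε.obj (Sub.mk (𝟙 E))).right := isZero_cokernel_of_epi (𝟙 E)
    rw [h0.eq_of_tgt x 0, map_zero]
  · refine isZero_G_obj r k fun x => cls_eq_zero_iff.2
      ⟨x ≫ cokernel.desc (0 : zeroModule ⟶ E) (𝟙 E) zero_comp, 0, zero_mem _, ?_⟩
    have h (y : E ⟶ cokernel (0 : zeroModule ⟶ E)) :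
        y = (y ≫ cokernel.desc (0 : zeroModule ⟶ E) (𝟙 E) zero_comp) ≫ cokernel.π _ + 0 := by
      have h1 : cokernel.desc (0 : zeroModule ⟶ E) (𝟙 E) zero_comp ≫ cokernel.π _ = 𝟙 _ := by
        rw [← cancel_epi (cokernel.π (0 : zeroModule ⟶ E))]
        simp
      rw [add_zero, Category.assoc, h1, Category.comp_id]
    exact h x

/-- On targets `φ` is `t ≫ Y.obj.hom + a ≫ b` with `a ≫ b` through a projective-injective `P`. The
first term passes through the identity of the source of `Y`, the second through the preimage in `P`
of that source, which lies in `U`. -/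
theorem exists_U_factor_of_F_map_eq_zero [IsNoetherianRing Λ]
    (hΛ : IsProjInj (FGModuleCat.of Λ Λ)) (hgen : ∀ M : FGModuleCat.{u} Λ, add E M)
    {X Y : Sub Λ} (φ : X ⟶ Y) (h : (F r k).map φ = 0) :
    ∃ (Z : Sub Λ) (a : X ⟶ Z) (b : Z ⟶ Y), U E Z ∧ φ = a ≫ b := by
  obtain ⟨t, p, hp, hφ⟩ := exists_eq_add_of_cls_eq_zero (r := r) (f := Y.obj) hgen φ.hom.right
    (cls_eq_zero_of_F_map_eq_zero r k h)
  obtain ⟨P, a, b, hP, rfl⟩ := exists_factor_isProjInj hΛ hp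
  let Q : Sub Λ := Sub.mk (pullback.fst b Y.obj.hom)
  have hQ : U E Q := U_of_isProjInj _ hP
  let Z : Sub Λ := (identityFunctor Λ).obj Y.obj.left
  have w : φ.hom.left ≫ Y.obj.hom = X.obj.hom ≫ φ.hom.right := Arrow.w φ.hom
  let a₁ : X ⟶ Z := ObjectProperty.homMk (Arrow.homMk (u := X.obj.hom ≫ t) (v := t)
    (Category.comp_id _))
  have hw : (X.obj.hom ≫ a) ≫ b = (φ.hom.left - X.obj.hom ≫ t) ≫ Y.obj.hom := by
    rw [Preadditive.sub_comp, w, hφ]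
    simp
  let a₂ : X ⟶ Q := ObjectProperty.homMk (Arrow.homMk (u := pullback.lift _ _ hw) (v := a)
    (pullback.lift_fst _ _ hw))
  let b₂ : Q ⟶ Y := ObjectProperty.homMk (Arrow.homMk (u := pullback.snd b Y.obj.hom) (v := b)
    pullback.condition.symm)
  refine ⟨Z ⊞ Q, biprod.lift a₁ a₂, biprod.desc (fromIdentity Y) b₂,
    (isAdditiveSubcategory_additiveClosure _).directSum _ _ (BinaryBiproduct.bicone _ _)
      ⟨BinaryBiproduct.isBilimit _ _⟩ (U_identityFunctor hgen _) hQ, ?_⟩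
  rw [biprod.lift_desc]
  exact Sub.hom_ext_right hφ

/-- The map of cokernels lifts to `t'` into the target of `Y`. Subtracting `t'` from `φ` on targets
leaves a map into the source of `Y`, so `φ` is a sum of a map through an identity and one through
`(0 ⟶ Coker X)`. -/
theorem exists_V_factor_of_G_map_eq_zero [IsNoetherianRing Λ]
    (hgen : ∀ M : FGModuleCat.{u} Λ, add E M)
    {X Y : Sub Λ} (φ : X ⟶ Y) (h : (G r k).map φ = 0) :
    ∃ (Z : Sub Λ) (a : X ⟶ Z) (b : Z ⟶ Y), V E Z ∧ φ = a ≫ b := by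
  obtain ⟨t, p, hp, hφ⟩ : ∃ (t : cokernel X.obj.hom ⟶ Y.obj.right)
      (p : cokernel X.obj.hom ⟶ cokernel Y.obj.hom), p ∈ projSubgroup _ _ ∧
        cokernelMap φ = t ≫ cokernel.π Y.obj.hom + p :=
    exists_eq_add_of_cls_eq_zero (r := r) (f := ε.obj Y) hgen (cokernelMap φ)
      (cls_eq_zero_of_G_map_eq_zero r k h)
  obtain ⟨p', -, rfl⟩ := exists_lift_mem_projSubgroup (cokernel.π Y.obj.hom) hp
  let t' := t + p'
  have ht' : cokernelMap φ = t' ≫ cokernel.π Y.obj.hom := by rw [hφ, Preadditive.add_comp]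
  have hs : (φ.hom.right - cokernel.π X.obj.hom ≫ t') ≫ cokernel.π Y.obj.hom = 0 := by
    rw [Preadditive.sub_comp, ← π_cokernelMap, ht', Category.assoc, sub_self]
  let s : X.obj.right ⟶ Y.obj.left := Abelian.monoLift Y.obj.hom _ hs
  have hs' : s ≫ Y.obj.hom = φ.hom.right - cokernel.π X.obj.hom ≫ t' :=
    Abelian.monoLift_comp _ _ hs
  let Z : Sub Λ := (identityFunctor Λ).obj Y.obj.left
  let Q : Sub Λ := (zeroFunctor Λ).obj (cokernel X.obj.hom)
  let a₁ : X ⟶ Z := ObjectProperty.homMk (Arrow.homMk (u := X.obj.hom ≫ s) (v := s)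
    (Category.comp_id _))
  let a₂ : X ⟶ Q := ObjectProperty.homMk (Arrow.homMk (u := 0) (v := cokernel.π X.obj.hom)
    (zero_comp.trans (cokernel.condition X.obj.hom).symm))
  let b₂ : Q ⟶ Y := ObjectProperty.homMk (Arrow.homMk (u := 0) (v := t')
    (zero_comp.trans zero_comp.symm))
  refine ⟨Z ⊞ Q, biprod.lift a₁ a₂, biprod.desc (fromIdentity Y) b₂,
    (isAdditiveSubcategory_additiveClosure _).directSum _ _ (BinaryBiproduct.bicone _ _)
      ⟨BinaryBiproduct.isBilimit _ _⟩ (V_identityFunctor hgen _) (V_zeroFunctor hgen _), ?_⟩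
  rw [biprod.lift_desc]
  refine Sub.hom_ext_right ?_
  change φ.hom.right = s ≫ Y.obj.hom + cokernel.π X.obj.hom ≫ t'
  rw [hs', sub_add_cancel]

/-- The map `g` on targets respects the submodules up to a map `p` through projectives. Extended to
the target of `X`, `p` can be subtracted from `g` without changing classes. -/
theorem exists_hom_of_hom_obj_mono (hΛ : IsProjInj (FGModuleCat.of Λ Λ))
    (hgen : ∀ M : FGModuleCat.{u} Λ, add E M) {X Y : Sub Λ}
    (φ : (α E ⋙ q r).obj X.obj ⟶ (α E ⋙ q r).obj Y.obj) :
    ∃ ψ : X ⟶ Y, (α E ⋙ q r).map ψ.hom = φ := by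
  obtain ⟨g, hg⟩ := exists_hom_of_hom_obj hgen φ
  obtain ⟨t, p, hp, e⟩ := exists_eq_add_of_cls_eq_zero (r := r) (f := Y.obj) hgen
    (X.obj.hom ≫ g) fun x => by
      have h0 : cls r X.obj (x ≫ X.obj.hom) = 0 :=
        cls_eq_zero_iff.2 ⟨x, 0, zero_mem _, (add_zero _).symm⟩
      rw [← Category.assoc, ← hg, h0, map_zero]
  obtain ⟨p', hp', rfl⟩ := exists_extension_mem_projSubgroup hΛ X.obj.hom hp
  let ψ : X ⟶ Y := ObjectProperty.homMk (Arrow.homMk (u := t) (v := g - p') (by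
    rw [Preadditive.comp_sub, e, add_sub_cancel_right]))
  have h1 : ψ.hom.right = g - p' := rfl
  refine ⟨ψ, hom_ext_cls fun x => ?_⟩
  have h0 := map_projSubgroup_eq_zero r (cls r Y.obj) (comp_left_mem_factorSubgroup x hp')
  rw [cls_naturality, hg, h1, Preadditive.comp_sub, map_sub, h0, sub_zero]

theorem full_lift {A B C : Type*} [Category* A] [Category* B] [Category* C] {P : ObjectProperty C}
    (T : A ⥤ B) (S : B ⥤ C) (hP : ∀ X, P ((T ⋙ S).obj X))
    (h : ∀ {X Y : A} (φ : S.obj (T.obj X) ⟶ S.obj (T.obj Y)), ∃ ψ : X ⟶ Y, S.map (T.map ψ) = φ) :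
    (P.lift (T ⋙ S) hP).Full where
  map_surjective φ := by
    obtain ⟨ψ, hψ⟩ := h φ.hom
    exact ⟨ψ, ObjectProperty.hom_ext _ hψ⟩

set_option maxHeartbeats 2000000 in
theorem full_F (k : Type*) [Field k] [Algebra k Λ] [Module.Finite k Λ]
    (hΛ : IsProjInj (FGModuleCat.of Λ Λ)) (hgen : ∀ M : FGModuleCat.{u} Λ, add E M) :
    (F r k).Full :=
  full_lift η (α E ⋙ q r) _ fun φ => exists_hom_of_hom_obj_mono r hΛ hgen φ

/-- A map `g` of cokernels inducing `φ` already lifts to the targets: the obstruction to lifting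
passes through projectives and hence lifts too. The lift restricts to the submodules. -/
theorem full_G [IsNoetherianRing Λ] (hgen : ∀ M : FGModuleCat.{u} Λ, add E M) :
    (G r k).Full where
  map_surjective {X Y} φ := by
    let φ' : (α E ⋙ q r).obj (ε.obj X) ⟶ (α E ⋙ q r).obj (ε.obj Y) := φ.hom
    obtain ⟨g, hg⟩ : ∃ g : cokernel X.obj.hom ⟶ cokernel Y.obj.hom, ∀ h,
        φ'.hom (cls r (ε.obj X) h) = cls r (ε.obj Y) (h ≫ g) := exists_hom_of_hom_obj hgen φ'
    have hg' (x : E ⟶ X.obj.right) :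
        cls r (ε.obj Y) (x ≫ cokernel.π X.obj.hom ≫ g) = 0 := by
      have h0 : cls r (ε.obj X) (x ≫ cokernel.π X.obj.hom) = 0 :=
        cls_eq_zero_iff.2 ⟨x, 0, zero_mem _, (add_zero _).symm⟩
      have h1 := hg (x ≫ cokernel.π X.obj.hom)
      rw [h0, map_zero] at h1
      exact (congrArg _ (Category.assoc _ _ _).symm).trans h1.symm
    obtain ⟨t, p, hp, e⟩ : ∃ (t : X.obj.right ⟶ Y.obj.right)
        (p : X.obj.right ⟶ cokernel Y.obj.hom), p ∈ projSubgroup _ _ ∧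
          cokernel.π X.obj.hom ≫ g = t ≫ cokernel.π Y.obj.hom + p :=
      exists_eq_add_of_cls_eq_zero (r := r) (f := ε.obj Y) hgen _ hg'
    obtain ⟨p', -, rfl⟩ := exists_lift_mem_projSubgroup (cokernel.π Y.obj.hom) hp
    obtain ⟨g₀, hg₀⟩ : ∃ g₀ : X.obj.right ⟶ Y.obj.right,
        cokernel.π X.obj.hom ≫ g = g₀ ≫ cokernel.π Y.obj.hom :=
      ⟨t + p', by rw [Preadditive.add_comp, e]⟩
    have hz : (X.obj.hom ≫ g₀) ≫ cokernel.π Y.obj.hom = 0 := by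
      rw [Category.assoc, ← hg₀, cokernel.condition_assoc, zero_comp]
    let ψ : X ⟶ Y := ObjectProperty.homMk (Arrow.homMk (u := Abelian.monoLift Y.obj.hom _ hz)
      (v := g₀) (Abelian.monoLift_comp _ _ hz))
    have hψ : (α E ⋙ q r).map (ε.map ψ) = φ' := hom_ext_cls fun x => by
      rw [cls_naturality, hg, ← cokernelMap_eq ψ hg₀]
      rfl
    exact ⟨ψ, ObjectProperty.hom_ext _ hψ⟩

theorem essSurj_F (hcog : ∀ M : FGModuleCat.{u} Λ,
      ∃ (I : FGModuleCat.{u} Λ) (_ : IsProjInj I) (f : M ⟶ I), Mono f) : (F r k).EssSurj where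
  mem_essImage N := by
    obtain ⟨M₁, M₀, g, ψ, hψ, hker⟩ := exists_presentation (r := r) k N
    obtain ⟨I, hI, i, hi⟩ := hcog M₁
    have := hI.1
    have : Module.Projective Λ I := moduleProjective_of_projective I
    have : Mono (biprod.lift g i) := mono_of_mono_fac (biprod.lift_snd g i)
    let X : Sub Λ := Sub.mk (biprod.lift g i)
    let fst' : (E ⟶ M₀ ⊞ I) →ₗ[Aus E] (E ⟶ M₀) :=
      { toFun := fun x => x ≫ biprod.fst
        map_add' := fun x y => Preadditive.add_comp _ _ _ _ _ _
        map_smul' := fun γ x => Category.assoc _ _ _ }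
    have hx (x : E ⟶ M₀ ⊞ I) : ψ (x ≫ biprod.fst) = 0 ↔ ∃ (u : E ⟶ M₁) (p : E ⟶ M₀ ⊞ I),
        p ∈ projSubgroup E (M₀ ⊞ I) ∧ x = u ≫ biprod.lift g i + p := by
      constructor
      · intro h0
        obtain ⟨u, hu⟩ := (hker _).1 h0
        -- The error lies in the component `I` only, hence passes through a projective; so adding
        -- `I` does not change the value.
        refine ⟨u, (x ≫ biprod.snd - u ≫ i) ≫ biprod.inr, mem_projSubgroup_of_factor _ _, ?_⟩
        apply biprod.hom_ext <;> simp [hu]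
      · rintro ⟨u, p, hp, rfl⟩
        rw [Preadditive.add_comp, map_add,
          map_projSubgroup_eq_zero r ψ (comp_right_mem_factorSubgroup biprod.fst hp), add_zero,
          hker]
        exact ⟨u, by simp⟩
    have hsurj (x : E ⟶ M₀) : (x ≫ biprod.inl) ≫ (biprod.fst : M₀ ⊞ I ⟶ M₀) = x := by simp
    obtain ⟨e⟩ := nonempty_iso_of_semilinear (f := X.obj) (N := N.obj) (ψ.comp fst')
      (hψ.comp fun x => ⟨_, hsurj x⟩) fun x => (hx x).trans (cls_eq_zero_iff (f := X.obj) (h := x)).symm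
    exact ⟨X, ⟨ObjectProperty.isoMk _ e⟩⟩

theorem essSurj_G [IsNoetherianRing Λ] : (G r k).EssSurj where
  mem_essImage N := by
    obtain ⟨M₁, M₀, g, ψ, hψ, hker⟩ := exists_presentation (r := r) k N
    obtain ⟨P, hP, π, hπ⟩ := exists_epi_projective M₀
    let d : M₁ ⊞ P ⟶ M₀ := biprod.desc g π
    have hd : Epi d := epi_of_epi_fac (biprod.inr_desc g π)
    let X : Sub Λ := Sub.mk (kernel.ι d)
    let c : cokernel (kernel.ι d) ⟶ M₀ := cokernel.desc _ d (kernel.condition d)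
    have hc : cokernel.π (kernel.ι d) ≫ c = d := cokernel.π_desc _ _ _
    let c' : M₀ ⟶ cokernel (kernel.ι d) := Abelian.epiDesc d (cokernel.π (kernel.ι d))
      (cokernel.condition _)
    have hc' : d ≫ c' = cokernel.π (kernel.ι d) := Abelian.comp_epiDesc _ _ _
    have hcc' : c ≫ c' = 𝟙 _ := by
      rw [← cancel_epi (cokernel.π (kernel.ι d)), reassoc_of% hc, hc', Category.comp_id]
    have hc'c : c' ≫ c = 𝟙 _ := by
      rw [← cancel_epi d, reassoc_of% hc', hc, Category.comp_id]
    let post : (E ⟶ cokernel (kernel.ι d)) →ₗ[Aus E] (E ⟶ M₀) :=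
      { toFun := fun x => x ≫ c
        map_add' := fun x y => Preadditive.add_comp _ _ _ _ _ _
        map_smul' := fun γ x => Category.assoc _ _ _ }
    have hx (x : E ⟶ cokernel (kernel.ι d)) : ψ (x ≫ c) = 0 ↔
        ∃ (u : E ⟶ M₁ ⊞ P) (p : E ⟶ cokernel (kernel.ι d)),
          p ∈ projSubgroup E (cokernel (kernel.ι d)) ∧ x = u ≫ cokernel.π (kernel.ι d) + p := by
      constructor
      · intro h0
        obtain ⟨u, hu⟩ := (hker _).1 h0
        refine ⟨u ≫ biprod.inl, 0, zero_mem _, ?_⟩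
        have hxc : x = (x ≫ c) ≫ c' := by rw [Category.assoc, hcc', Category.comp_id]
        have hd' : biprod.inl ≫ d = g := biprod.inl_desc g π
        rw [hxc, hu, add_zero, ← hc', Category.assoc, Category.assoc, reassoc_of% hd']
      · rintro ⟨u, p, hp, rfl⟩
        have hu : u ≫ d = (u ≫ biprod.fst) ≫ g + (u ≫ biprod.snd) ≫ π := by
          rw [← biprod.lift_desc]
          congr 1
          apply biprod.hom_ext <;> simp
        -- The summand `P` contributes only maps through a projective, so making `g` epi does not
        -- change the value.
        have h2 := map_projSubgroup_eq_zero r ψ (mem_projSubgroup_of_factor (u ≫ biprod.snd) π)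
        rw [Preadditive.add_comp, Category.assoc, hc, map_add,
          map_projSubgroup_eq_zero r ψ (comp_right_mem_factorSubgroup c hp), add_zero, hu,
          map_add, h2, add_zero, hker]
        exact ⟨_, rfl⟩
    have hsurj (x : E ⟶ M₀) : (x ≫ c') ≫ c = x := by
      rw [Category.assoc, hc'c, Category.comp_id]
    obtain ⟨e⟩ := nonempty_iso_of_semilinear (f := ε.obj X) (N := N.obj) (ψ.comp post)
      (hψ.comp fun x => ⟨_, hsurj x⟩) fun x => (hx x).trans (cls_eq_zero_iff (f := ε.obj X) (h := x)).symm
    exact ⟨X, ⟨ObjectProperty.isoMk _ e⟩⟩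

end F

end Functors

end SubmoduleCategory

end

open SubmoduleCategory in
theorem theorem1 (k : Type*) [Field k] (Λ : Type u) [Ring Λ] [Algebra k Λ] [Module.Finite k Λ]
    -- `Λ` is basic, self-injective and representation-finite
    (hbasic : SubmoduleCategory.IsBasic (FGModuleCat.of Λ Λ))
    (hinj : Module.Injective.{u, u} Λ Λ)
    (hfin : (SubmoduleCategory.indClasses (⊤ : ObjectProperty (FGModuleCat.{u} Λ))).Finite)
    -- `E` is the basic additive generator, with a chosen projection onto its summand `Λ`
    (E : FGModuleCat.{u} Λ) (hE : SubmoduleCategory.IsBasic E)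
    (hgen : ∀ M : FGModuleCat.{u} Λ, SubmoduleCategory.add E M)
    (r : Retract (FGModuleCat.of Λ Λ) E) :
    (SubmoduleCategory.indClasses (SubmoduleCategory.U E)).encard =
        2 * (SubmoduleCategory.indClasses (⊤ : ObjectProperty (FGModuleCat.{u} Λ))).encard ∧
      (SubmoduleCategory.indClasses (SubmoduleCategory.V E)).encard =
        2 * (SubmoduleCategory.indClasses (⊤ : ObjectProperty (FGModuleCat.{u} Λ))).encard ∧
      SubmoduleCategory.InducesEquivalence (SubmoduleCategory.U E) (SubmoduleCategory.F r k) ∧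
      SubmoduleCategory.InducesEquivalence (SubmoduleCategory.V E) (SubmoduleCategory.G r k) := by
  have : IsNoetherianRing Λ := isNoetherianRing_of_finite k
  have hΛ : IsProjInj (FGModuleCat.of Λ Λ) :=
    (isProjInj_iff _).2 ⟨inferInstanceAs (Module.Projective Λ Λ), hinj⟩
  have hcog := exists_mono_isProjInj k hbasic hΛ
  have := full_F r k hΛ hgen
  have := essSurj_F r k hcog
  have := full_G r k hgen
  have := essSurj_G r k
  exact ⟨encard_indClasses_U k hgen hcog, encard_indClasses_V k hgen,
    inducesEquivalence_of _ _ (fun _ => isZero_F_obj_of_U r k)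
      (fun _ _ φ => exists_U_factor_of_F_map_eq_zero r k hΛ hgen φ),
    inducesEquivalence_of _ _ (fun _ => isZero_G_obj_of_V r k)
      (fun _ _ φ => exists_V_factor_of_G_map_eq_zero r k hgen φ)⟩
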